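/- Let $a,b,d\in C^0[0,1]$ satisfy $\frac ba\in L^1(0,1)$, $a(0)=d(0)=0$, $a,d>0$ on $(0,1]$, and let $K_1,K_2\in(0,2)$ be such that $x\mapsto \frac{x^{K_1}}{a(x)}$ and $x\mapsto\frac{x^{K_2}}{d(x)}$ are nondecreasing in a right neighbourhood of $x=0$. Put $\eta(x)=\exp\big(\int_{1/2}^x\frac{b(s)}{a(s)}\,ds\big)$ and $\sigma=a/\eta$ on $[0,1]$, and let $$L^2_{1/\sigma}=\Big\{u\in L^2(0,1):\int_0^1\tfrac{u^2}{\sigma}\,dx<\infty\Big\},\qquad \|u\|_{1/\sigma}^2=\int_0^1\frac{u^2}{\sigma}\,dx,$$ $$H^1_{1/\sigma,0}=\{u\in L^2_{1/\sigma}\cap H^1(0,1): u(0)=0\},\qquad \|u\|_{1,1/\sigma}^2=\|u\|_{1/\sigma}^2+\int_0^1\eta (u')^2\,dx.$$ Assume $K_1+2K_2\le 2$ (in particular, this covers the case in which $a$ and $d$ belong to $C^0[0,1]\cap C^1(0,1]$, $K_a:=\sup_{(0,1]}\frac{x|a'|}{a}$ and $K_d:=\sup_{(0,1]}\frac{x|d'|}{d}$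 lie in $(0,2)$, and $K_a+2K_d\le 2$: take $K_1=K_a$, $K_2=K_d$). Let $C_{HP}$ be the best constant $C$ in the inequality $\int_0^1\frac{u^2}{\sigma d}\,dx\le C\int_0^1\eta(u')^2dx$ for $u\in H^1_{1/\sigma,0}$, let $\lambda\in\mathbb R\setminus\{0\}$ with $\lambda<\frac1{C_{HP}}$, and let $\beta\ge0$. Define $Au=\sigma(\eta u')'$ (in the sense of distributions) on $D(A)=\{u\in H^1_{1/\sigma,0}: Au\in L^2_{1/\sigma}\}$, and $A_\lambda u=Au+\lambda\frac ud$ on $D(A_\lambda)=\{u\in D(A): A_\lambda u\in L^2_{1/\sigma}\}$. On $\mathcal H_0=H^1_{1/\sigma,0}\times L^2_{1/\sigma}$, with its product norm, consider the form $$\langle (u,v),(\tilde u,\tilde v)\rangle_1=\int_0^1\eta u'\tilde u'\,dx+\int_0^1\frac{v\tilde v}{\sigma}\,dx-\lambda\int_0^1\frac{u\tilde u}{\sigma d}\,dx+\beta u(1)\tilde u(1)$$ and the operator $$\mathcal A(u,v)=(v,A_\lambda u),\qquad D(\mathcal A)=\{(u,v)\in D(A_\lambda)\times H^1_{1/\sigma,0}:\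 \eta(1)u'(1)+v(1)+\beta u(1)=0\}.$$ Then $\mathcal H_0$ is complete, $\langle\cdot,\cdot\rangle_1$ is an inner product on $\mathcal H_0$ whose norm $\|\cdot\|_1$ is equivalent to the product norm, and: 1. $D(\mathcal A)$ is dense in $\mathcal H_0$; 2. $\mathcal A$ is dissipative (non positive): $\langle\mathcal A z,z\rangle_1\le 0$ for all $z\in D(\mathcal A)$; 3. $I-\mathcal A:D(\mathcal A)\to\mathcal H_0$ is surjective; 4. $\mathcal A$ generates a strongly continuous semigroup $(S(t))_{t\ge0}$ of contractions: there is a strongly continuous semigroup $(S(t))_{t\ge 0}$ of bounded linear operators on $\mathcal H_0$ whose generator is exactly $(\mathcal A,D(\mathcal A))$, and $\|S(t)z\|_1\le\|z\|_1$ for all $t\ge0$, $z\in\mathcal H_0$. -/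

import Mathlib

open MeasureTheory Set Filter Topology
open scoped NNReal ContDiff

noncomputable section

namespace DegWave

/-! ### Distributional derivatives on the interval `(0,1)` -/

/-- Test functions: the elements of `C_c^∞(0,1)`. -/
def IsTest (φ : ℝ → ℝ) : Prop :=
  ContDiff ℝ ∞ φ ∧ HasCompactSupport φ ∧ tsupport φ ⊆ Ioo (0 : ℝ) 1

/-- `w` is the weak (distributional) derivative of `u` on `(0,1)`, for locally integrable `u`, `w`. -/
structure IsWeakDeriv (u w : ℝ → ℝ) : Prop where
  left : LocallyIntegrableOn u (Ioo 0 1)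
  right : LocallyIntegrableOn w (Ioo 0 1)
  eq : ∀ φ : ℝ → ℝ, IsTest φ →
    ∫ x in Ioo (0 : ℝ) 1, u x * deriv φ x = - ∫ x in Ioo (0 : ℝ) 1, w x * φ x

theorem integrableOn_mul_test {f ψ : ℝ → ℝ} (hf : LocallyIntegrableOn f (Ioo (0 : ℝ) 1))
    (hc : Continuous ψ) (hs : HasCompactSupport ψ) (ht : tsupport ψ ⊆ Ioo (0 : ℝ) 1) :
    IntegrableOn (fun x => f x * ψ x) (Ioo (0 : ℝ) 1) := by
  have h1 : IntegrableOn f (tsupport ψ) := hf.integrableOn_compact_subset ht hs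
  have h2 : IntegrableOn (fun x => f x * ψ x) (tsupport ψ) :=
    h1.mul_continuousOn hc.continuousOn hs
  have h3 : Integrable (fun x => f x * ψ x) := by
    refine (integrableOn_iff_integrable_of_support_subset ?_).1 h2
    intro x hx
    apply subset_tsupport
    intro h
    exact hx (by simp [h])
  exact h3.integrableOn

theorem IsTest.integrableOn_mul {f φ : ℝ → ℝ} (hφ : IsTest φ)
    (hf : LocallyIntegrableOn f (Ioo (0 : ℝ) 1)) :
    IntegrableOn (fun x => f x * φ x) (Ioo (0 : ℝ) 1) :=
  integrableOn_mul_test hf hφ.1.continuous hφ.2.1 hφ.2.2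

theorem IsTest.integrableOn_mul_deriv {f φ : ℝ → ℝ} (hφ : IsTest φ)
    (hf : LocallyIntegrableOn f (Ioo (0 : ℝ) 1)) :
    IntegrableOn (fun x => f x * deriv φ x) (Ioo (0 : ℝ) 1) :=
  integrableOn_mul_test hf (hφ.1.continuous_deriv (by simp)) hφ.2.1.deriv
    (tsupport_deriv_subset.trans hφ.2.2)

theorem locallyIntegrableOn_congr {f g : ℝ → ℝ} (h : f =ᵐ[volume.restrict (Ioo (0 : ℝ) 1)] g)
    (hf : LocallyIntegrableOn f (Ioo (0 : ℝ) 1)) : LocallyIntegrableOn g (Ioo (0 : ℝ) 1) := by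
  rw [locallyIntegrableOn_iff isOpen_Ioo.isLocallyClosed] at hf ⊢
  intro k hk hc
  exact (hf k hk hc).congr_fun_ae (ae_restrict_of_ae_restrict_of_subset hk h)

theorem IsWeakDeriv.zero : IsWeakDeriv (fun _ => 0) (fun _ => 0) where
  left := (locallyIntegrable_const 0).locallyIntegrableOn _
  right := (locallyIntegrable_const 0).locallyIntegrableOn _
  eq := by intro φ _; simp

theorem IsWeakDeriv.add {u w u' w' : ℝ → ℝ} (h : IsWeakDeriv u w) (h' : IsWeakDeriv u' w') :
    IsWeakDeriv (fun x => u x + u' x) (fun x => w x + w' x) where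
  left := h.left.add h'.left
  right := h.right.add h'.right
  eq := by
    intro φ hφ
    simp only [add_mul]
    rw [integral_add (hφ.integrableOn_mul_deriv h.left) (hφ.integrableOn_mul_deriv h'.left),
      integral_add (hφ.integrableOn_mul h.right) (hφ.integrableOn_mul h'.right),
      h.eq φ hφ, h'.eq φ hφ]
    ring

theorem IsWeakDeriv.smul {u w : ℝ → ℝ} (c : ℝ) (h : IsWeakDeriv u w) :
    IsWeakDeriv (fun x => c * u x) (fun x => c * w x) where
  left := h.left.smul c
  right := h.right.smul c
  eq := by
    intro φ hφ
    simp only [mul_assoc]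
    rw [integral_const_mul, integral_const_mul, h.eq φ hφ]
    ring

theorem IsWeakDeriv.congr {u w u' w' : ℝ → ℝ} (h : IsWeakDeriv u w)
    (hu : u =ᵐ[volume.restrict (Ioo (0 : ℝ) 1)] u')
    (hw : w =ᵐ[volume.restrict (Ioo (0 : ℝ) 1)] w') : IsWeakDeriv u' w' where
  left := locallyIntegrableOn_congr hu h.left
  right := locallyIntegrableOn_congr hw h.right
  eq := by
    intro φ hφ
    have h1 : ∫ x in Ioo (0 : ℝ) 1, u' x * deriv φ x = ∫ x in Ioo (0 : ℝ) 1, u x * deriv φ x :=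
      integral_congr_ae (hu.mono fun x hx => by simp [hx])
    have h2 : ∫ x in Ioo (0 : ℝ) 1, w' x * φ x = ∫ x in Ioo (0 : ℝ) 1, w x * φ x :=
      integral_congr_ae (hw.mono fun x hx => by simp [hx])
    rw [h1, h2, h.eq φ hφ]

/-- Weak derivatives are unique almost everywhere. -/
theorem IsWeakDeriv.unique {u w w' : ℝ → ℝ} (h : IsWeakDeriv u w) (h' : IsWeakDeriv u w') :
    w =ᵐ[volume.restrict (Ioo (0 : ℝ) 1)] w' := by
  have key := isOpen_Ioo.ae_eq_zero_of_integral_contDiff_smul_eq_zero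
    (h.right.sub h'.right) (μ := volume) (f := w - w') ?_
  · rw [EventuallyEq, ae_restrict_iff' measurableSet_Ioo]
    filter_upwards [key] with x hx hx'
    have := hx hx'
    simpa [sub_eq_zero] using this
  · intro g g1 g2 g3
    have hg : IsTest g := ⟨g1, g2, g3⟩
    rw [← setIntegral_eq_integral_of_forall_compl_eq_zero (s := Ioo (0 : ℝ) 1)]
    · have e : ∀ x, g x • (w - w') x = w x * g x - w' x * g x := by
        intro x; simp only [Pi.sub_apply, smul_eq_mul]; ring
      simp only [e]
      rw [integral_sub (hg.integrableOn_mul h.right) (hg.integrableOn_mul h'.right)]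
      have e1 := h.eq g hg
      have e2 := h'.eq g hg
      linarith
    · intro x hx
      rw [image_eq_zero_of_notMem_tsupport (fun hh => hx (g3 hh))]
      simp

/-! ### The coefficients and the weights -/

/-- The coefficients `a`, `b`, `d` of the equation: continuous on `[0,1]`, with `b / a ∈ L¹(0,1)`,
`a(0) = d(0) = 0` and `a, d > 0` on `(0,1]`. (Values outside `[0,1]` play no role.) -/
structure Coefficients where
  a : ℝ → ℝ
  b : ℝ → ℝ
  d : ℝ → ℝ
  continuousOn_a : ContinuousOn a (Icc 0 1)
  continuousOn_b : ContinuousOn b (Icc 0 1)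
  continuousOn_d : ContinuousOn d (Icc 0 1)
  integrableOn_div : IntegrableOn (fun x => b x / a x) (Ioo 0 1)
  a_zero : a 0 = 0
  d_zero : d 0 = 0
  a_pos : ∀ x ∈ Ioc (0 : ℝ) 1, 0 < a x
  d_pos : ∀ x ∈ Ioc (0 : ℝ) 1, 0 < d x

namespace Coefficients

variable (P : Coefficients)

/-- The degeneracy exponents: `K₁, K₂ ∈ (0,2)` and both `x ^ K₁ / a(x)` and `x ^ K₂ / d(x)` are
nondecreasing in a right neighbourhood of `0`. -/
def HasExponents (K₁ K₂ : ℝ) : Prop :=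
  K₁ ∈ Ioo (0 : ℝ) 2 ∧ K₂ ∈ Ioo (0 : ℝ) 2 ∧
    (∃ δ > 0, MonotoneOn (fun x : ℝ => x ^ K₁ / P.a x) (Ioo 0 δ)) ∧
    (∃ δ > 0, MonotoneOn (fun x : ℝ => x ^ K₂ / P.d x) (Ioo 0 δ))

/-- The weight `η(x) = exp (∫_{1/2}^x b / a)`. -/
def eta (x : ℝ) : ℝ := Real.exp (∫ s in (1 / 2 : ℝ)..x, P.b s / P.a s)

/-- The weight `σ = a / η`. -/
def sigma (x : ℝ) : ℝ := P.a x / P.eta x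

theorem eta_pos (x : ℝ) : 0 < P.eta x := Real.exp_pos _

theorem sigma_pos {x : ℝ} (hx : x ∈ Ioc (0 : ℝ) 1) : 0 < P.sigma x :=
  div_pos (P.a_pos x hx) (P.eta_pos x)

theorem continuousOn_eta : ContinuousOn P.eta (Icc 0 1) := by
  have hi : IntervalIntegrable (fun x => P.b x / P.a x) volume 0 1 := by
    rw [intervalIntegrable_iff_integrableOn_Ioo_of_le zero_le_one]
    exact P.integrableOn_div
  have h := intervalIntegral.continuousOn_primitive_interval' (a := (1 / 2 : ℝ)) hi
    (by rw [uIcc_of_le zero_le_one]; constructor <;> norm_num)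
  rw [uIcc_of_le zero_le_one] at h
  exact Real.continuous_exp.comp_continuousOn h

theorem continuousOn_sigma : ContinuousOn P.sigma (Icc 0 1) :=
  P.continuousOn_a.div P.continuousOn_eta fun x _ => (P.eta_pos x).ne'

/-- The measure `dx / σ` on `(0,1)`. -/
def sigmaMeasure : Measure ℝ :=
  (volume.restrict (Ioo 0 1)).withDensity fun x => ENNReal.ofReal (1 / P.sigma x)

/-- The measure `η dx` on `(0,1)`. -/
def etaMeasure : Measure ℝ :=
  (volume.restrict (Ioo 0 1)).withDensity fun x => ENNReal.ofReal (P.eta x)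

theorem ae_of_ae_withDensity {ρ : ℝ → ℝ} (hc : ContinuousOn ρ (Ioo 0 1))
    (hp : ∀ x ∈ Ioo (0 : ℝ) 1, 0 < ρ x) :
    volume.restrict (Ioo (0 : ℝ) 1) ≪
      (volume.restrict (Ioo (0 : ℝ) 1)).withDensity fun x => ENNReal.ofReal (ρ x) := by
  refine withDensity_absolutelyContinuous' ?_ ?_
  · exact (hc.aemeasurable measurableSet_Ioo).ennreal_ofReal
  · filter_upwards [ae_restrict_mem measurableSet_Ioo] with x hx
    simpa using hp x hx

theorem absolutelyContinuous_sigmaMeasure :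
    volume.restrict (Ioo (0 : ℝ) 1) ≪ P.sigmaMeasure := by
  have hpos : ∀ x ∈ Ioo (0 : ℝ) 1, 0 < P.sigma x := fun x hx => P.sigma_pos (Ioo_subset_Ioc_self hx)
  refine ae_of_ae_withDensity (ρ := fun x => 1 / P.sigma x) ?_ ?_
  · exact continuousOn_const.div (P.continuousOn_sigma.mono Ioo_subset_Icc_self)
      fun x hx => (hpos x hx).ne'
  · intro x hx
    exact one_div_pos.2 (hpos x hx)

theorem absolutelyContinuous_etaMeasure :
    volume.restrict (Ioo (0 : ℝ) 1) ≪ P.etaMeasure :=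
  ae_of_ae_withDensity (P.continuousOn_eta.mono Ioo_subset_Icc_self) fun x _ => P.eta_pos x

/-! ### Function spaces -/

/-- The Hilbert space `L²_{1/σ}(0,1)`, with inner product `∫ u v / σ`. (As `σ` is bounded, its
elements are automatically in `L²(0,1)`.) -/
abbrev L2 : Type := Lp ℝ 2 P.sigmaMeasure

/-- The Hilbert space `L²(0,1)` with the equivalent inner product `∫ η f g`; it contains the
derivatives of `H¹` functions. (`η` is bounded above and away from `0`.) -/
abbrev L2eta : Type := Lp ℝ 2 P.etaMeasure

theorem L2_add (f g : P.L2) :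
    ⇑(f + g) =ᵐ[volume.restrict (Ioo (0 : ℝ) 1)] fun x => f x + g x :=
  P.absolutelyContinuous_sigmaMeasure.ae_le (Lp.coeFn_add f g)

theorem L2_smul (c : ℝ) (f : P.L2) :
    ⇑(c • f) =ᵐ[volume.restrict (Ioo (0 : ℝ) 1)] fun x => c * f x :=
  P.absolutelyContinuous_sigmaMeasure.ae_le (Lp.coeFn_smul c f)

theorem L2_zero : ⇑(0 : P.L2) =ᵐ[volume.restrict (Ioo (0 : ℝ) 1)] fun _ => 0 :=
  P.absolutelyContinuous_sigmaMeasure.ae_le (Lp.coeFn_zero ℝ 2 P.sigmaMeasure)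

theorem L2eta_add (f g : P.L2eta) :
    ⇑(f + g) =ᵐ[volume.restrict (Ioo (0 : ℝ) 1)] fun x => f x + g x :=
  P.absolutelyContinuous_etaMeasure.ae_le (Lp.coeFn_add f g)

theorem L2eta_smul (c : ℝ) (f : P.L2eta) :
    ⇑(c • f) =ᵐ[volume.restrict (Ioo (0 : ℝ) 1)] fun x => c * f x :=
  P.absolutelyContinuous_etaMeasure.ae_le (Lp.coeFn_smul c f)

theorem L2eta_zero : ⇑(0 : P.L2eta) =ᵐ[volume.restrict (Ioo (0 : ℝ) 1)] fun _ => 0 :=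
  P.absolutelyContinuous_etaMeasure.ae_le (Lp.coeFn_zero ℝ 2 P.etaMeasure)

/-- `U` is a representative of `u`, continuous on `[0,1]` and with `U(0) = 0`. -/
def IsRep (u : P.L2) (U : ℝ → ℝ) : Prop :=
  ContinuousOn U (Icc 0 1) ∧ ⇑u =ᵐ[volume.restrict (Ioo (0 : ℝ) 1)] U ∧ U 0 = 0

variable {P} in
theorem IsRep.eqOn {u : P.L2} {U V : ℝ → ℝ} (hU : P.IsRep u U) (hV : P.IsRep u V) :
    EqOn U V (Icc 0 1) := by
  refine Measure.eqOn_Icc_of_ae_eq volume zero_ne_one ?_ hU.1 hV.1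
  rw [← restrict_Ioo_eq_restrict_Icc]
  exact hU.2.1.symm.trans hV.2.1

variable {P} in
theorem IsRep.add {u v : P.L2} {U V : ℝ → ℝ} (hU : P.IsRep u U) (hV : P.IsRep v V) :
    P.IsRep (u + v) (fun x => U x + V x) := by
  refine ⟨hU.1.add hV.1, ?_, by simp [hU.2.2, hV.2.2]⟩
  filter_upwards [P.L2_add u v, hU.2.1, hV.2.1] with x h1 h2 h3
  rw [h1, h2, h3]

variable {P} in
theorem IsRep.smul {u : P.L2} {U : ℝ → ℝ} (c : ℝ) (hU : P.IsRep u U) :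
    P.IsRep (c • u) (fun x => c * U x) := by
  refine ⟨continuousOn_const.mul hU.1, ?_, by simp [hU.2.2]⟩
  filter_upwards [P.L2_smul c u, hU.2.1] with x h1 h2
  rw [h1, h2]

/-- The space `H¹_{1/σ,0}(0,1)` of the functions `u ∈ L²_{1/σ}(0,1) ∩ H¹(0,1)` with `u(0) = 0`,
realised as the space of the pairs `(u, u')`, with inner product `∫ u v / σ + ∫ η u' v'`. -/
def H10 : Submodule ℝ (WithLp 2 (P.L2 × P.L2eta)) where
  carrier := {p | IsWeakDeriv p.fst p.snd ∧ ∃ U : ℝ → ℝ, P.IsRep p.fst U}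
  zero_mem' :=
    ⟨IsWeakDeriv.zero.congr P.L2_zero.symm P.L2eta_zero.symm, fun _ => 0, continuousOn_const,
      P.L2_zero, rfl⟩
  add_mem' := by
    rintro p q ⟨hp, U, hU⟩ ⟨hq, V, hV⟩
    exact ⟨(hp.add hq).congr (P.L2_add p.fst q.fst).symm (P.L2eta_add p.snd q.snd).symm,
      _, hU.add hV⟩
  smul_mem' := by
    rintro c p ⟨hp, U, hU⟩
    exact ⟨(hp.smul c).congr (P.L2_smul c p.fst).symm (P.L2eta_smul c p.snd).symm,
      _, hU.smul c⟩

variable {P}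

/-- The inclusion `H¹_{1/σ,0}(0,1) ⊂ L²_{1/σ}(0,1)`. -/
def toL2 (u : P.H10) : P.L2 := (u : WithLp 2 (P.L2 × P.L2eta)).fst

/-- The derivative `u'` of `u ∈ H¹_{1/σ,0}(0,1)`, an element of `L²(0,1)`. -/
def der (u : P.H10) : P.L2eta := (u : WithLp 2 (P.L2 × P.L2eta)).snd

/-- The continuous representative of `u ∈ H¹_{1/σ,0}(0,1)`; it is unique on `[0,1]`. -/
def rep (u : P.H10) : ℝ → ℝ := Classical.choose u.2.2

theorem rep_spec (u : P.H10) : P.IsRep (toL2 u) (rep u) := Classical.choose_spec u.2.2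

theorem rep_zero : EqOn (rep (0 : P.H10)) (fun _ => 0) (Icc 0 1) :=
  (rep_spec (0 : P.H10)).eqOn ⟨continuousOn_const, P.L2_zero, rfl⟩

theorem rep_add (u v : P.H10) : EqOn (rep (u + v)) (fun x => rep u x + rep v x) (Icc 0 1) :=
  (rep_spec (u + v)).eqOn ((rep_spec u).add (rep_spec v))

theorem rep_smul (c : ℝ) (u : P.H10) : EqOn (rep (c • u)) (fun x => c * rep u x) (Icc 0 1) :=
  (rep_spec (c • u)).eqOn ((rep_spec u).smul c)

variable (P)

/-- The best constant `C_HP` in the Hardy–Poincaré inequality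
`∫ u² / (σ d) ≤ C ∫ η (u')²`, `u ∈ H¹_{1/σ,0}(0,1)`. -/
def hardyConst : ℝ :=
  sInf {C : ℝ | 0 < C ∧ ∀ u : P.H10,
    IntegrableOn (fun x => rep u x ^ 2 / (P.sigma x * P.d x)) (Ioo 0 1) ∧
    ∫ x in Ioo (0 : ℝ) 1, rep u x ^ 2 / (P.sigma x * P.d x) ≤
      C * ∫ x in Ioo (0 : ℝ) 1, P.eta x * der u x ^ 2}

/-- The phase space `H¹_{1/σ,0}(0,1) × L²_{1/σ}(0,1)`, with the Hilbert product norm. -/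
abbrev Phase : Type := WithLp 2 (P.H10 × P.L2)

/-- The energy inner product
`⟨(u,v),(ũ,ṽ)⟩ = ∫ η u' ũ' + ∫ v ṽ / σ - λ ∫ u ũ / (σ d) + β u(1) ũ(1)`. -/
def energyInner (lam β : ℝ) (y z : P.Phase) : ℝ :=
  (∫ x in Ioo (0 : ℝ) 1, P.eta x * der y.fst x * der z.fst x)
    + (∫ x in Ioo (0 : ℝ) 1, y.snd x * z.snd x / P.sigma x)
    - lam * (∫ x in Ioo (0 : ℝ) 1, rep y.fst x * rep z.fst x / (P.sigma x * P.d x))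
    + β * rep y.fst 1 * rep z.fst 1

/-! ### The operators -/

variable {P}

/-- `u ∈ D(A)` and `A u = h`: the distribution `A u = σ (η u')'` is the element `h` of
`L²_{1/σ}(0,1)`. -/
def IsA (u : P.H10) (h : P.L2) : Prop :=
  IsWeakDeriv (fun x => P.eta x * der u x) (fun x => h x / P.sigma x)

/-- `u ∈ D(A_λ)` and `A_λ u = g`, where `A_λ u = A u + λ u / d` and
`D(A_λ) = {u ∈ D(A) : A_λ u ∈ L²_{1/σ}(0,1)}`. -/
def IsALambda (lam : ℝ) (u : P.H10) (g : P.L2) : Prop :=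
  ∃ h : P.L2, IsA u h ∧
    ⇑g =ᵐ[volume.restrict (Ioo (0 : ℝ) 1)] fun x => h x + lam * (rep u x / P.d x)

/-- The boundary condition `η(1) u'(1) + v(1) + β u(1) = 0`, where `u'(1)` is the (one-sided)
derivative of `u` at `1`. -/
def BoundaryCondition (β : ℝ) (u v : P.H10) : Prop :=
  ∃ q : ℝ, HasDerivWithinAt (rep u) q (Icc 0 1) 1 ∧ P.eta 1 * q + rep v 1 + β * rep u 1 = 0

theorem IsALambda.zero (lam : ℝ) : IsALambda lam (0 : P.H10) 0 := by
  refine ⟨0, IsWeakDeriv.zero.congr ?_ ?_, ?_⟩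
  · filter_upwards [P.L2eta_zero] with x hx
    change 0 = P.eta x * (0 : P.L2eta) x
    rw [hx, mul_zero]
  · filter_upwards [P.L2_zero] with x hx
    rw [hx, zero_div]
  · filter_upwards [P.L2_zero, ae_restrict_mem measurableSet_Ioo] with x hx hx'
    rw [hx, rep_zero (Ioo_subset_Icc_self hx')]
    simp

theorem IsALambda.add {lam : ℝ} {u v : P.H10} {f g : P.L2} (hu : IsALambda lam u f)
    (hv : IsALambda lam v g) : IsALambda lam (u + v) (f + g) := by
  obtain ⟨h, h1, h2⟩ := hu
  obtain ⟨k, k1, k2⟩ := hv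
  refine ⟨h + k, (IsWeakDeriv.add h1 k1).congr ?_ ?_, ?_⟩
  · filter_upwards [P.L2eta_add (der u) (der v)] with x hx
    change _ = P.eta x * (der u + der v : P.L2eta) x
    rw [hx, mul_add]
  · filter_upwards [P.L2_add h k] with x hx
    rw [hx, add_div]
  · filter_upwards [P.L2_add h k, P.L2_add f g, h2, k2, ae_restrict_mem measurableSet_Ioo]
      with x x1 x2 x3 x4 hx
    rw [x1, x2, x3, x4, rep_add u v (Ioo_subset_Icc_self hx)]
    ring

theorem IsALambda.smul {lam : ℝ} (c : ℝ) {u : P.H10} {f : P.L2} (hu : IsALambda lam u f) :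
    IsALambda lam (c • u) (c • f) := by
  obtain ⟨h, h1, h2⟩ := hu
  refine ⟨c • h, (IsWeakDeriv.smul c h1).congr ?_ ?_, ?_⟩
  · filter_upwards [P.L2eta_smul c (der u)] with x hx
    change _ = P.eta x * (c • der u : P.L2eta) x
    rw [hx]
    ring
  · filter_upwards [P.L2_smul c h] with x hx
    rw [hx]
    ring
  · filter_upwards [P.L2_smul c h, P.L2_smul c f, h2, ae_restrict_mem measurableSet_Ioo]
      with x x1 x2 x3 hx
    rw [x1, x2, x3, rep_smul c u (Ioo_subset_Icc_self hx)]
    ring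

theorem IsALambda.unique {lam : ℝ} {u : P.H10} {f g : P.L2} (hf : IsALambda lam u f)
    (hg : IsALambda lam u g) : f = g := by
  obtain ⟨h, h1, h2⟩ := hf
  obtain ⟨k, k1, k2⟩ := hg
  apply Lp.ext
  refine (withDensity_absolutelyContinuous (volume.restrict (Ioo (0 : ℝ) 1)) _).ae_le ?_
  filter_upwards [IsWeakDeriv.unique h1 k1, h2, k2, ae_restrict_mem measurableSet_Ioo]
    with x x1 x2 x3 hx
  have hs := (P.sigma_pos (Ioo_subset_Ioc_self hx)).ne'
  have : h x = k x := by
    field_simp at x1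
    exact x1
  rw [x2, x3, this]

theorem BoundaryCondition.zero (β : ℝ) : BoundaryCondition β (0 : P.H10) 0 := by
  have h1 : (1 : ℝ) ∈ Icc (0 : ℝ) 1 := by simp
  refine ⟨0, ?_, ?_⟩
  · exact (hasDerivWithinAt_const (1 : ℝ) (Icc (0 : ℝ) 1) (0 : ℝ)).congr
      (fun x hx => rep_zero hx) (rep_zero h1)
  · rw [rep_zero h1]
    simp

theorem BoundaryCondition.add {β : ℝ} {u v u' v' : P.H10} (h : BoundaryCondition β u v)
    (h' : BoundaryCondition β u' v') : BoundaryCondition β (u + u') (v + v') := by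
  have h1 : (1 : ℝ) ∈ Icc (0 : ℝ) 1 := by simp
  obtain ⟨q, a1, a2⟩ := h
  obtain ⟨r, b1, b2⟩ := h'
  refine ⟨q + r, ?_, ?_⟩
  · exact (a1.add b1).congr (fun x hx => rep_add u u' hx) (rep_add u u' h1)
  · rw [rep_add u u' h1, rep_add v v' h1]
    linear_combination a2 + b2

theorem BoundaryCondition.smul {β : ℝ} (c : ℝ) {u v : P.H10} (h : BoundaryCondition β u v) :
    BoundaryCondition β (c • u) (c • v) := by
  have h1 : (1 : ℝ) ∈ Icc (0 : ℝ) 1 := by simp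
  obtain ⟨q, a1, a2⟩ := h
  refine ⟨c * q, ?_, ?_⟩
  · exact (a1.const_mul c).congr (fun x hx => rep_smul c u hx) (rep_smul c u h1)
  · rw [rep_smul c u h1, rep_smul c v h1]
    linear_combination c * a2

variable (P)

/-- The graph of the matrix operator `𝒜`: the pairs `((u, v), (v, A_λ u))` with `u ∈ D(A_λ)`,
`v ∈ H¹_{1/σ,0}(0,1)` and `η(1) u'(1) + v(1) + β u(1) = 0`. -/
def waveGraph (lam β : ℝ) : Submodule ℝ (P.Phase × P.Phase) where
  carrier := {p | IsALambda lam p.1.fst p.2.snd ∧ toL2 p.2.fst = p.1.snd ∧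
    BoundaryCondition β p.1.fst p.2.fst}
  zero_mem' := ⟨IsALambda.zero lam, rfl, BoundaryCondition.zero β⟩
  add_mem' := by
    rintro p q ⟨h1, h2, h3⟩ ⟨k1, k2, k3⟩
    refine ⟨h1.add k1, ?_, h3.add k3⟩
    change toL2 p.2.fst + toL2 q.2.fst = p.1.snd + q.1.snd
    rw [h2, k2]
  smul_mem' := by
    rintro c p ⟨h1, h2, h3⟩
    refine ⟨h1.smul c, ?_, h3.smul c⟩
    change c • toL2 p.2.fst = c • p.1.snd
    rw [h2]

/-- The operator `𝒜 = [[0, I], [A_λ, 0]]` on the phase space, with domain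
`{(u,v) ∈ D(A_λ) × H¹_{1/σ,0}(0,1) : η(1) u'(1) + v(1) + β u(1) = 0}`. -/
def waveOp (lam β : ℝ) : P.Phase →ₗ.[ℝ] P.Phase := (P.waveGraph lam β).toLinearPMap

variable {P} in
/-- An element of `H¹_{1/σ,0}(0,1)` is determined by its first component. -/
theorem toL2_injective {u v : P.H10} (h : toL2 u = toL2 v) : u = v := by
  have hw : der u = der v := by
    apply Lp.ext
    refine (withDensity_absolutelyContinuous (volume.restrict (Ioo (0 : ℝ) 1)) _).ae_le ?_
    have hu : IsWeakDeriv (toL2 u) (der u) := u.2.1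
    have hv : IsWeakDeriv (toL2 v) (der v) := v.2.1
    rw [← h] at hv
    exact hu.unique hv
  apply Subtype.ext
  exact WithLp.ofLp_injective 2 (Prod.ext h hw)

/-- `𝒜` is well defined: `waveGraph` is the graph of `waveOp`. -/
theorem waveOp_graph (lam β : ℝ) : (P.waveOp lam β).graph = P.waveGraph lam β := by
  refine Submodule.toLinearPMap_graph_eq _ ?_
  rintro ⟨x, y⟩ ⟨h1, h2, -⟩ h0
  dsimp only at h1 h2 h0
  subst h0
  have e1 : y.snd = 0 := h1.unique (IsALambda.zero lam)
  have e2 : y.fst = 0 := toL2_injective h2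
  exact WithLp.ofLp_injective 2 (Prod.ext e2 e1)

end Coefficients

/-! ### Semigroups -/

section Semigroup

variable {X : Type*} [NormedAddCommGroup X] [NormedSpace ℝ X]

/-- `B` is an inner product on `X` whose norm is equivalent to the given norm of `X`. -/
structure IsEquivInner (B : X → X → ℝ) : Prop where
  symm : ∀ x y, B x y = B y x
  add_left : ∀ x y z, B (x + y) z = B x z + B y z
  smul_left : ∀ (c : ℝ) (x y), B (c • x) y = c * B x y
  equiv : ∃ m M : ℝ, 0 < m ∧ ∀ x, m * ‖x‖ ^ 2 ≤ B x x ∧ B x x ≤ M * ‖x‖ ^ 2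

/-- Strongly continuous one-parameter semigroups of bounded operators. -/
structure IsC0Semigroup (S : ℝ≥0 → X →L[ℝ] X) : Prop where
  zero : S 0 = ContinuousLinearMap.id ℝ X
  add : ∀ s t, S (s + t) = (S s).comp (S t)
  continuous : ∀ x, Continuous fun t => S t x

/-- `A` is the generator of `S`: `x ∈ D(A)` and `A x = y` if and only if
`(S(t) x - x) / t → y` as `t → 0⁺`. -/
def IsGenerator (A : X →ₗ.[ℝ] X) (S : ℝ≥0 → X →L[ℝ] X) : Prop :=
  ∀ x y : X, (x, y) ∈ A.graph ↔
    Tendsto (fun t : ℝ≥0 => (t : ℝ)⁻¹ • (S t x - x)) (𝓝[>] 0) (𝓝 y)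

end Semigroup

end DegWave

end

/-!
The form domain `H¹_{1/σ,0}` is identified with `L²(0,1)` through `u ↦ u'`: by the du Bois-Reymond
lemma `u` is the primitive of `u'` that vanishes at `0` (`rep_eq_integral`). The monotonicity
conditions give `a ≥ c x ^ K₁` and `d ≥ c x ^ K₂`, so `K₁ + 2 K₂ ≤ 2` yields `σ d² ≥ c x²`
(`HasExponents.quadraticBound`). With the classical Hardy inequality `∫ u² / x² ≤ C ∫ (u')²`
(`hardy`), the map `u ↦ u / d` is therefore bounded from `H¹_{1/σ,0}` to `L²_{1/σ}` and controlled by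
`‖u'‖` alone. Consequently `u ↦ ‖u'‖` is an equivalent norm, `D(A_λ) = D(A)`, and for `λ < 1 / C_HP`
the energy form is an equivalent inner product (`isEquivInner_energyInner`).

The heart of the analysis is Green's formula `∫ η u' v' + ∫ (A u) v / σ = η(1) u'(1) v(1)`
(`IsA.green`). The flux `η u'` may be unbounded at `0`, but `η u' v` has a limit there, and a nonzero
limit would force `(η u')² ≥ c / x` because `v² = O(x)`, contradicting `u' ∈ L²`
(`eq_zero_of_tendsto_mul`). Green's formula and the boundary condition give
`⟨𝒜 z, z⟩ = -v(1)²`, hence dissipativity. For `μ > 0` the equation `(μ - 𝒜) z = w` reduces to a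
coercive variational problem for the first component of `z`, solved by Lax–Milgram; testing with
`C_c^∞(0,1)` gives the differential equation, and Green's formula then gives the boundary condition
(`QuadraticBound.exists_waveGraph_sub`).

The semigroup comes from the Lumer–Phillips theorem (`exists_contraction_semigroup`), proved with the
Yosida approximations `μ² (μ - 𝒜)⁻¹ - μ` and stated for an inner product `B` that is only equivalent
to the one of the Hilbert space. Density of the domain is automatic: a vector orthogonal to it is of
the form `z - 𝒜 z` with `z` in the domain, and then `B (z - 𝒜 z) z ≥ B z z` forces `z = 0`.
-/

namespace DegWave

/-! ### Equivalent inner products -/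

section LumerPhillips

variable {X : Type*} [NormedAddCommGroup X]

section Inner

variable [NormedSpace ℝ X] {B : X → X → ℝ}

namespace IsEquivInner

/-- The bilinear form underlying an equivalent inner product. -/
noncomputable def bilin (hB : IsEquivInner B) : LinearMap.BilinForm ℝ X :=
  LinearMap.mk₂ ℝ B hB.add_left hB.smul_left
    (fun x y z => by rw [hB.symm, hB.add_left, hB.symm y, hB.symm z])
    (fun c x y => by rw [hB.symm, hB.smul_left, hB.symm y, smul_eq_mul])

@[simp]
theorem bilin_apply (hB : IsEquivInner B) (x y : X) : hB.bilin x y = B x y := rfl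

theorem self_nonneg (hB : IsEquivInner B) (x : X) : 0 ≤ B x x := by
  obtain ⟨m, M, hm, h⟩ := hB.equiv
  exact le_trans (by positivity) (h x).1

theorem eq_zero_of_self_nonpos (hB : IsEquivInner B) {x : X} (hx : B x x ≤ 0) : x = 0 := by
  obtain ⟨m, M, hm, h⟩ := hB.equiv
  have h1 : m * ‖x‖ ^ 2 ≤ 0 := (h x).1.trans hx
  have h2 : ‖x‖ ^ 2 ≤ 0 := by
    by_contra hc
    push Not at hc
    have := mul_pos hm hc
    linarith
  simpa using le_antisymm h2 (sq_nonneg _)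

theorem exists_bound (hB : IsEquivInner B) : ∃ M : ℝ, ∀ x y, ‖hB.bilin x y‖ ≤ M * ‖x‖ * ‖y‖ := by
  obtain ⟨m, M, hm, h⟩ := hB.equiv
  refine ⟨|M|, fun x y => ?_⟩
  have cs := hB.bilin.apply_mul_apply_le_of_forall_zero_le hB.self_nonneg x y
  simp only [bilin_apply, hB.symm y x] at cs
  have h1 : B x x ≤ |M| * ‖x‖ ^ 2 := (h x).2.trans (by gcongr; exact le_abs_self M)
  have h2 : B y y ≤ |M| * ‖y‖ ^ 2 := (h y).2.trans (by gcongr; exact le_abs_self M)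
  rw [bilin_apply, Real.norm_eq_abs]
  refine abs_le_of_sq_le_sq ?_ (by positivity)
  calc B x y ^ 2 = B x y * B x y := sq _
    _ ≤ B x x * B y y := cs
    _ ≤ (|M| * ‖x‖ ^ 2) * (|M| * ‖y‖ ^ 2) :=
      mul_le_mul h1 h2 (hB.self_nonneg y) (by positivity)
    _ = (|M| * ‖x‖ * ‖y‖) ^ 2 := by ring

/-- An equivalent inner product as a bounded bilinear form. -/
noncomputable def clm (hB : IsEquivInner B) : X →L[ℝ] X →L[ℝ] ℝ :=
  hB.bilin.mkContinuous₂ hB.exists_bound.choose hB.exists_bound.choose_spec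

theorem clm_apply (hB : IsEquivInner B) (x y : X) : hB.clm x y = B x y := rfl

theorem continuous_apply (hB : IsEquivInner B) {Y : Type*} [TopologicalSpace Y] {f g : Y → X}
    (hf : Continuous f) (hg : Continuous g) : Continuous fun t => B (f t) (g t) := by
  simp only [← hB.clm_apply]
  fun_prop

theorem tendsto_apply (hB : IsEquivInner B) {ι : Type*} {l : Filter ι} {f g : ι → X} {x y : X}
    (hf : Tendsto f l (𝓝 x)) (hg : Tendsto g l (𝓝 y)) :
    Tendsto (fun t => B (f t) (g t)) l (𝓝 (B x y)) :=
  (((hB.continuous_apply continuous_fst continuous_snd).tendsto (x, y)).comp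
    (hf.prodMk_nhds hg))

theorem hasDerivAt_self (hB : IsEquivInner B) {f : ℝ → X} {f' : X} {t : ℝ}
    (hf : HasDerivAt f f' t) : HasDerivAt (fun t => B (f t) (f t)) (2 * B f' (f t)) t := by
  have h1 : HasDerivAt (fun s => hB.clm (f s)) (hB.clm f') t :=
    hB.clm.hasFDerivAt.comp_hasDerivAt t hf
  have h := h1.clm_apply hf
  simp only [hB.clm_apply] at h
  have e : B f' (f t) + B (f t) f' = 2 * B f' (f t) := by
    rw [hB.symm (f t) f']
    ring
  exact e ▸ h

/-- Comparisons in the norm of `B` hold in the norm of `X` up to a uniform constant. -/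
theorem exists_norm_le (hB : IsEquivInner B) :
    ∃ K : ℝ, 0 < K ∧ ∀ c : ℝ, 0 ≤ c → ∀ x y, B x x ≤ c ^ 2 * B y y → ‖x‖ ≤ K * c * ‖y‖ := by
  obtain ⟨m, M, hm, h⟩ := hB.equiv
  refine ⟨√((|M| + 1) / m), by positivity, fun c hc x y hxy => ?_⟩
  have h1 : m * ‖x‖ ^ 2 ≤ c ^ 2 * ((|M| + 1) * ‖y‖ ^ 2) := by
    refine (h x).1.trans (hxy.trans ?_)
    gcongr
    refine (h y).2.trans ?_
    gcongr
    linarith [le_abs_self M]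
  refine le_of_sq_le_sq ?_ (by positivity)
  rw [mul_pow, mul_pow, Real.sq_sqrt (by positivity), div_mul_eq_mul_div, div_mul_eq_mul_div,
    le_div_iff₀ hm]
  linarith

end IsEquivInner

end Inner

/-! ### Exponentials of bounded dissipative operators -/

section Exp

variable [NormedSpace ℝ X]

/-- Uniformly bounded operators that tend to zero on a dense set tend to zero everywhere. -/
theorem tendsto_zero_of_dense {Y : Type*} [NormedAddCommGroup Y] [NormedSpace ℝ Y] {ι : Type*}
    {l : Filter ι} {F : ι → X →L[ℝ] Y} {K : ℝ} (hK : ∀ᶠ i in l, ∀ x, ‖F i x‖ ≤ K * ‖x‖) {D : Set X}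
    (hD : Dense D) (h : ∀ x ∈ D, Tendsto (fun i => F i x) l (𝓝 0)) (x : X) :
    Tendsto (fun i => F i x) l (𝓝 0) := by
  rw [Metric.tendsto_nhds]
  intro ε hε
  obtain ⟨y, hy, hxy⟩ := hD.exists_dist_lt x (ε := ε / (2 * (|K| + 1))) (by positivity)
  filter_upwards [hK, Metric.tendsto_nhds.1 (h y hy) (ε / 2) (by positivity)] with i h1 h2
  rw [dist_zero_right] at h2 ⊢
  rw [dist_eq_norm] at hxy
  have h3 : ‖F i (x - y)‖ ≤ (|K| + 1) * ‖x - y‖ := by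
    refine (h1 _).trans ?_
    gcongr
    linarith [le_abs_self K]
  have h4 : (|K| + 1) * ‖x - y‖ < ε / 2 := by
    rw [lt_div_iff₀ (by positivity)] at hxy
    linarith
  calc ‖F i x‖ = ‖F i (x - y) + F i y‖ := by rw [map_sub, sub_add_cancel]
    _ ≤ ‖F i (x - y)‖ + ‖F i y‖ := norm_add_le _ _
    _ < ε := by linarith

/-- The uniformly continuous semigroup `e^{tT}` of a bounded operator `T`. -/
noncomputable def expSG (T : X →L[ℝ] X) (t : ℝ) : X →L[ℝ] X := NormedSpace.exp (t • T)

@[simp]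
theorem expSG_zero (T : X →L[ℝ] X) : expSG T 0 = 1 := by simp [expSG]

@[simp]
theorem expSG_zero_op (t : ℝ) : expSG (0 : X →L[ℝ] X) t = 1 := by simp [expSG]

theorem commute_expSG {S T : X →L[ℝ] X} (h : Commute S T) (t : ℝ) : Commute S (expSG T t) :=
  (h.smul_right t).exp_right

variable [CompleteSpace X]

theorem expSG_add (T : X →L[ℝ] X) (s t : ℝ) : expSG T (s + t) = expSG T s * expSG T t := by
  let := NormedAlgebra.restrictScalars ℚ ℝ (X →L[ℝ] X)
  rw [expSG, add_smul]
  exact NormedSpace.exp_add_of_commute (((Commute.refl T).smul_left s).smul_right t)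

theorem hasDerivAt_expSG (T : X →L[ℝ] X) (x : X) (t : ℝ) :
    HasDerivAt (fun s => expSG T s x) (expSG T t (T x)) t := by
  have h := (hasDerivAt_exp_smul_const (𝕂 := ℝ) T t).clm_apply (hasDerivAt_const t x)
  simpa [expSG] using h

theorem hasDerivAt_expSG' (T : X →L[ℝ] X) (x : X) (t : ℝ) :
    HasDerivAt (fun s => expSG T s x) (T (expSG T t x)) t := by
  have h := hasDerivAt_expSG T x t
  have e := DFunLike.congr_fun (commute_expSG (Commute.refl T) t).eq x
  simp only [mul_apply_eq_comp] at e
  rwa [e]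

theorem IsEquivInner.expSG_le {B : X → X → ℝ} (hB : IsEquivInner B) {T : X →L[ℝ] X}
    (hT : ∀ x, B (T x) x ≤ 0) {t : ℝ} (ht : 0 ≤ t) (x : X) :
    B (expSG T t x) (expSG T t x) ≤ B x x := by
  have hd : ∀ s, HasDerivAt (fun s => B (expSG T s x) (expSG T s x))
      (2 * B (T (expSG T s x)) (expSG T s x)) s := fun s =>
    hB.hasDerivAt_self (hasDerivAt_expSG' T x s)
  have hanti : Antitone fun s => B (expSG T s x) (expSG T s x) := by
    refine antitone_of_deriv_nonpos (fun s => (hd s).differentiableAt) fun s => ?_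
    rw [(hd s).deriv]
    linarith [hT (expSG T s x)]
  simpa using hanti ht

/-- Two commuting bounded operators generate semigroups whose distance is controlled by the
distance of the operators. -/
theorem norm_expSG_sub_expSG_le {S T : X →L[ℝ] X} (h : Commute S T) {K L : ℝ} (hK0 : 0 ≤ K)
    (hK : ∀ s, 0 ≤ s → ∀ x, ‖expSG S s x‖ ≤ K * ‖x‖)
    (hL : ∀ s, 0 ≤ s → ∀ x, ‖expSG T s x‖ ≤ L * ‖x‖) {t : ℝ} (ht : 0 ≤ t) (x : X) :
    ‖expSG S t x - expSG T t x‖ ≤ K * L * ‖S x - T x‖ * t := by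
  have hd : ∀ s, HasDerivAt (fun s => expSG S s (expSG T (t - s) x))
      (expSG S s (expSG T (t - s) (S x - T x))) s := by
    intro s
    have h1 : HasDerivAt (fun s => expSG T (t - s) x) (-(expSG T (t - s) (T x))) s := by
      have := (hasDerivAt_expSG T x (t - s)).scomp s ((hasDerivAt_id s).const_sub t)
      rw [neg_one_smul] at this
      exact this
    have h2 : HasDerivAt (fun s => expSG S s) (expSG S s * S) s :=
      hasDerivAt_exp_smul_const (𝕂 := ℝ) S s
    have h3 := h2.clm_apply h1
    have e := DFunLike.congr_fun (commute_expSG h (t - s)).eq x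
    simp only [mul_apply_eq_comp] at e
    convert h3 using 1
    rw [mul_apply_eq_comp, e, ← map_add, map_sub, sub_eq_add_neg]
  have hb := norm_image_sub_le_of_norm_deriv_le_segment' (a := 0) (b := t)
    (C := K * L * ‖S x - T x‖) (fun s _ => (hd s).hasDerivWithinAt) ?_ t ⟨ht, le_rfl⟩
  · simpa using hb
  · intro s hs
    refine (hK s hs.1 _).trans ?_
    rw [mul_assoc]
    gcongr
    exact hL _ (by linarith [hs.2]) _

theorem norm_expSG_sub_le {T : X →L[ℝ] X} {K : ℝ} (hK0 : 0 ≤ K)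
    (hK : ∀ s, 0 ≤ s → ∀ x, ‖expSG T s x‖ ≤ K * ‖x‖) {t : ℝ} (ht : 0 ≤ t) (x : X) :
    ‖expSG T t x - x‖ ≤ K * ‖T x‖ * t := by
  simpa using norm_expSG_sub_expSG_le (Commute.zero_right T) hK0 hK (L := 1) (by simp) ht x

/-- First-order expansion of `e^{tT} x` at `t = 0`, uniform in `T`: the defect is measured by means
of an arbitrary vector `y`, to be chosen close to `T x`. -/
theorem norm_expSG_sub_sub_le {T : X →L[ℝ] X} {K : ℝ} (hK0 : 0 ≤ K)
    (hK : ∀ s, 0 ≤ s → ∀ x, ‖expSG T s x‖ ≤ K * ‖x‖) {t : ℝ} (ht : 0 ≤ t) (x y : X) :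
    ‖expSG T t x - x - t • T x‖ ≤ ((K + 1) * ‖T x - y‖ + K * ‖T y‖ * t) * t := by
  have hd : ∀ s, HasDerivAt (fun s => expSG T s x - s • T x) (expSG T s (T x) - T x) s := by
    intro s
    have h2 : HasDerivAt (fun s : ℝ => s • T x) (T x) s := by
      simpa using (hasDerivAt_id s).smul_const (T x)
    exact (hasDerivAt_expSG T x s).sub h2
  have hb := norm_image_sub_le_of_norm_deriv_le_segment' (a := 0) (b := t)
    (C := (K + 1) * ‖T x - y‖ + K * ‖T y‖ * t) (fun s _ => (hd s).hasDerivWithinAt) ?_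
    t ⟨ht, le_rfl⟩
  · have e : expSG T t x - x - t • T x = expSG T t x - t • T x - x := by abel
    rw [e]
    simpa using hb
  · intro s hs
    have e : expSG T s (T x) - T x
        = expSG T s (T x - y) + (expSG T s y - y) - (T x - y) := by
      rw [map_sub]; abel
    rw [e]
    have h1 := hK s hs.1 (T x - y)
    have h2 : ‖expSG T s y - y‖ ≤ K * ‖T y‖ * t :=
      (norm_expSG_sub_le hK0 hK hs.1 y).trans (by gcongr; exact hs.2.le)
    have h3 := norm_sub_le (expSG T s (T x - y) + (expSG T s y - y)) (T x - y)
    have h4 := norm_add_le (expSG T s (T x - y)) (expSG T s y - y)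
    linarith

end Exp
end LumerPhillips

/-! ### Generation of contraction semigroups -/

section Generation

section Limit

variable {X : Type*} [NormedAddCommGroup X] [NormedSpace ℝ X] [CompleteSpace X]

/-- Commuting bounded operators `T n` which generate uniformly bounded semigroups and converge on a
dense subset have semigroups that converge strongly. The limit is a strongly continuous semigroup,
and it is differentiable at `0` on the vectors `x` for which `T n x` converges. -/
theorem exists_limit_semigroup {T : ℕ → X →L[ℝ] X} (hT : ∀ n m, Commute (T n) (T m)) {K : ℝ}
    (hK0 : 0 ≤ K) (hK : ∀ n s, 0 ≤ s → ∀ x, ‖expSG (T n) s x‖ ≤ K * ‖x‖)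
    (hD : Dense {x | ∃ y, Tendsto (fun n => T n x) atTop (𝓝 y)}) :
    ∃ S : ℝ≥0 → X →L[ℝ] X, IsC0Semigroup S ∧
      (∀ (t : ℝ≥0) x, Tendsto (fun n => expSG (T n) t x) atTop (𝓝 (S t x))) ∧
      ∀ x y, Tendsto (fun n => T n x) atTop (𝓝 y) →
        Tendsto (fun t : ℝ≥0 => (t : ℝ)⁻¹ • (S t x - x)) (𝓝[>] 0) (𝓝 y) := by
  have hcauchy : ∀ (t : ℝ≥0) x, CauchySeq fun n => expSG (T n) t x := by
    intro t x
    have key : Tendsto (fun p : ℕ × ℕ => (expSG (T p.1) t - expSG (T p.2) t) x) atTop (𝓝 0) := by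
      refine tendsto_zero_of_dense (K := K + K) (Eventually.of_forall fun p z => ?_) hD ?_ x
      · refine (norm_sub_le _ _).trans ?_
        rw [add_mul]
        exact add_le_add (hK _ _ t.2 z) (hK _ _ t.2 z)
      · rintro z ⟨y, hy⟩
        have hc : Tendsto (fun p : ℕ × ℕ => K * K * ‖T p.1 z - T p.2 z‖ * t) atTop (𝓝 0) := by
          have h1 : Tendsto (fun p : ℕ × ℕ => T p.1 z - T p.2 z) atTop (𝓝 (y - y)) := by
            rw [← prod_atTop_atTop_eq]
            exact (hy.comp tendsto_fst).sub (hy.comp tendsto_snd)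
          have h2 := (h1.norm.const_mul (K * K)).mul_const (t : ℝ)
          simpa using h2
        exact squeeze_zero_norm (fun p => norm_expSG_sub_expSG_le (hT p.1 p.2) hK0 (hK p.1)
          (hK p.2) t.2 z) hc
    rw [cauchySeq_iff_tendsto_dist_atTop_0]
    simpa [dist_eq_norm] using key.norm
  choose f hf using fun (t : ℝ≥0) x => cauchySeq_tendsto_of_complete (hcauchy t x)
  let S : ℝ≥0 → X →L[ℝ] X := fun t =>
    continuousLinearMapOfTendsto (fun n => expSG (T n) t) (tendsto_pi_nhds.2 (hf t))
  have hS : ∀ (t : ℝ≥0) x, Tendsto (fun n => expSG (T n) t x) atTop (𝓝 (S t x)) := hf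
  have hSK : ∀ t x, ‖S t x‖ ≤ K * ‖x‖ := fun t x =>
    le_of_tendsto (hS t x).norm (Eventually.of_forall fun n => hK n t t.2 x)
  have hadd : ∀ s t, S (s + t) = (S s).comp (S t) := by
    intro s t
    ext x
    refine tendsto_nhds_unique (hS (s + t) x) ?_
    have h0 : Tendsto (fun n => K * ‖expSG (T n) t x - S t x‖) atTop (𝓝 0) := by
      simpa using ((tendsto_sub_nhds_zero_iff.2 (hS t x)).norm).const_mul K
    have h1 : Tendsto (fun n => expSG (T n) s (expSG (T n) t x - S t x)) atTop (𝓝 0) :=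
      squeeze_zero_norm (fun n => hK n s s.2 _) h0
    have h2 := h1.add (hS s (S t x))
    rw [zero_add] at h2
    refine h2.congr fun n => ?_
    rw [NNReal.coe_add, expSG_add, mul_apply_eq_comp, map_sub, sub_add_cancel]
  have hlip : ∀ x y, Tendsto (fun n => T n x) atTop (𝓝 y) → ∀ t, ‖S t x - x‖ ≤ K * ‖y‖ * t := by
    intro x y hy t
    exact le_of_tendsto_of_tendsto' ((hS t x).sub_const x).norm
      ((hy.norm.const_mul K).mul_const (t : ℝ)) fun n => norm_expSG_sub_le hK0 (hK n) t.2 x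
  -- The Lipschitz bound at `0` is transported to all times by the semigroup law.
  have hdist : ∀ x y, Tendsto (fun n => T n x) atTop (𝓝 y) → ∀ s t,
      ‖S s x - S t x‖ ≤ K * (K * ‖y‖ * dist s t) := by
    intro x y hy
    have aux : ∀ s t : ℝ≥0, s ≤ t → ‖S t x - S s x‖ ≤ K * (K * ‖y‖ * dist t s) := by
      intro s t hst
      obtain ⟨r, rfl⟩ := exists_add_of_le hst
      have e : S (s + r) x - S s x = S s (S r x - x) := by
        rw [hadd, map_sub]; rfl
      rw [e]
      refine (hSK _ _).trans ?_
      gcongr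
      have e2 : dist (s + r) s = r := by
        rw [NNReal.dist_eq]; simp
      rw [e2]
      exact hlip x y hy r
    intro s t
    rcases le_total s t with h | h
    · rw [norm_sub_rev, dist_comm]; exact aux s t h
    · exact aux t s h
  refine ⟨S, ⟨?_, hadd, ?_⟩, hS, ?_⟩
  · ext x
    refine tendsto_nhds_unique (hS 0 x) ?_
    simp
  · intro x
    rw [continuous_iff_continuousAt]
    intro t
    have key : Tendsto (fun s => (S s - S t) x) (𝓝 t) (𝓝 0) := by
      refine tendsto_zero_of_dense (K := K + K) (Eventually.of_forall fun p z => ?_) hD ?_ x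
      · refine (norm_sub_le _ _).trans ?_
        rw [add_mul]
        exact add_le_add (hSK _ z) (hSK _ z)
      · rintro z ⟨y, hy⟩
        refine squeeze_zero_norm (fun s => hdist z y hy s t) ?_
        have h := ((tendsto_id (x := 𝓝 t)).dist tendsto_const_nhds (b := t))
        simpa using (h.const_mul (K * ‖y‖)).const_mul K
    exact tendsto_sub_nhds_zero_iff.1 key
  · intro x y hy
    rw [Metric.tendsto_nhds]
    intro ε hε
    obtain ⟨w, ⟨v, hv⟩, hwy⟩ := hD.exists_dist_lt y (ε := ε / (2 * (K + 1))) (by positivity)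
    rw [dist_eq_norm, lt_div_iff₀ (by positivity)] at hwy
    have hexp : ∀ t : ℝ≥0, ‖S t x - x - (t : ℝ) • y‖ ≤
        ((K + 1) * ‖y - w‖ + K * ‖v‖ * t) * t := by
      intro t
      refine le_of_tendsto_of_tendsto' (((hS t x).sub_const x).sub (hy.const_smul (t : ℝ))).norm
        ((((hy.sub_const w).norm.const_mul (K + 1)).add
          ((hv.norm.const_mul K).mul_const (t : ℝ))).mul_const (t : ℝ))
        fun n => norm_expSG_sub_sub_le hK0 (hK n) t.2 x w
    have hsmall : ∀ᶠ t : ℝ≥0 in 𝓝[>] 0, K * ‖v‖ * (t : ℝ) < ε / 2 := by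
      have h : Tendsto (fun t : ℝ≥0 => K * ‖v‖ * (t : ℝ)) (𝓝 0) (𝓝 0) := by
        have hc : Continuous fun t : ℝ≥0 => K * ‖v‖ * (t : ℝ) := by fun_prop
        simpa using hc.tendsto 0
      exact (h.mono_left nhdsWithin_le_nhds).eventually (gt_mem_nhds (by positivity))
    filter_upwards [hsmall, self_mem_nhdsWithin] with t h1 h2
    have ht : (0 : ℝ) < t := by exact_mod_cast h2
    have e : (t : ℝ)⁻¹ • (S t x - x) - y = (t : ℝ)⁻¹ • (S t x - x - (t : ℝ) • y) := by
      rw [smul_sub _ _ ((t : ℝ) • y), inv_smul_smul₀ ht.ne']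
    rw [dist_eq_norm, e, norm_smul, norm_inv, Real.norm_of_nonneg ht.le, inv_mul_lt_iff₀ ht]
    refine (hexp t).trans_lt ?_
    rw [mul_comm]
    gcongr
    linarith

end Limit

section Dissipative

variable {X : Type*} [NormedAddCommGroup X]

section Resolvent

variable [NormedSpace ℝ X] {B : X → X → ℝ}

/-- The resolvent estimate, with `y` in the role of `A x` for a dissipative operator `A`. -/
theorem IsEquivInner.sq_mul_le (hB : IsEquivInner B) {x y : X} (h : B y x ≤ 0) {μ : ℝ}
    (hμ : 0 ≤ μ) : μ ^ 2 * B x x ≤ B (μ • x - y) (μ • x - y) := by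
  have e : B (μ • x - y) (μ • x - y) = μ ^ 2 * B x x - 2 * μ * B y x + B y y := by
    simp only [← hB.bilin_apply, map_sub, map_smul, LinearMap.sub_apply, LinearMap.smul_apply,
      smul_eq_mul]
    simp only [hB.bilin_apply, hB.symm x y]
    ring
  have := hB.self_nonneg y
  have := mul_nonpos_of_nonneg_of_nonpos hμ h
  linarith

/-- The resolvent `(μ - A)⁻¹` of a dissipative operator `A` such that `μ - A` is onto. -/
theorem exists_resolvent (hB : IsEquivInner B) {A : X →ₗ.[ℝ] X}
    (hdiss : ∀ x y, (x, y) ∈ A.graph → B y x ≤ 0) {μ : ℝ} (hμ : 0 < μ)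
    (hsurj : ∀ f, ∃ x y, (x, y) ∈ A.graph ∧ μ • x - y = f) :
    ∃ R : X →L[ℝ] X, (∀ f, (R f, μ • R f - f) ∈ A.graph) ∧
      (∀ x y, (x, y) ∈ A.graph → R (μ • x - y) = x) ∧
      ∀ f, B (R f) (R f) ≤ (1 / μ) ^ 2 * B f f := by
  have hle : ∀ x y, (x, y) ∈ A.graph → B x x ≤ (1 / μ) ^ 2 * B (μ • x - y) (μ • x - y) := by
    intro x y h
    have := hB.sq_mul_le (hdiss x y h) hμ.le
    rw [one_div, inv_pow, inv_mul_eq_div, le_div_iff₀ (by positivity)]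
    linarith
  have huniq : ∀ x y x' y', (x, y) ∈ A.graph → (x', y') ∈ A.graph →
      μ • x - y = μ • x' - y' → x = x' := by
    intro x y x' y' h h' e
    have h1 := hle _ _ (A.graph.sub_mem h h')
    have e1 : μ • (x - x') - (y - y') = 0 := by
      rw [smul_sub, sub_sub_sub_comm, e, sub_self]
    have e2 : B 0 0 = 0 := by rw [← hB.bilin_apply]; simp
    simp only [e1, e2, mul_zero] at h1
    exact sub_eq_zero.1 (hB.eq_zero_of_self_nonpos h1)
  choose r s hr hrs using hsurj
  have hR : ∀ f x y, (x, y) ∈ A.graph → μ • x - y = f → r f = x := fun f x y h e =>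
    huniq _ _ _ _ (hr f) h ((hrs f).trans e.symm)
  have hrle : ∀ f, B (r f) (r f) ≤ (1 / μ) ^ 2 * B f f := by
    intro f
    have := hle _ _ (hr f)
    rwa [hrs f] at this
  let L : X →ₗ[ℝ] X :=
    { toFun := r
      map_add' := fun f g => hR _ _ _ (A.graph.add_mem (hr f) (hr g)) (by
        rw [smul_add, add_sub_add_comm, hrs, hrs])
      map_smul' := fun c f => hR _ _ _ (A.graph.smul_mem c (hr f)) (by
        change μ • c • r f - c • s f = c • f
        rw [smul_comm, ← smul_sub, hrs]) }
  obtain ⟨K, hK, hKle⟩ := hB.exists_norm_le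
  refine ⟨L.mkContinuous (K * (1 / μ)) fun f => hKle _ (by positivity) _ _ (hrle f), ?_, ?_, hrle⟩
  · intro f
    have e : s f = μ • r f - f := by
      rw [eq_sub_iff_add_eq, add_comm]
      exact (sub_eq_iff_eq_add.1 (hrs f)).symm
    have := hr f
    rwa [e] at this
  · intro x y h
    exact hR _ _ _ h rfl

end Resolvent

variable [InnerProductSpace ℝ X] {B : X → X → ℝ}

theorem IsEquivInner.isCoercive (hB : IsEquivInner B) : IsCoercive hB.clm := by
  obtain ⟨m, M, hm, h⟩ := hB.equiv
  refine ⟨m, hm, fun x => ?_⟩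
  rw [hB.clm_apply, mul_assoc, ← sq]
  exact (h x).1

variable [CompleteSpace X]

/-- A dissipative operator `A` on a Hilbert space with `I - A` onto is densely defined: a vector
orthogonal to the domain is of the form `x - A x`, and `B (x - A x) x ≥ B x x`. -/
theorem dense_domain_of_dissipative (hB : IsEquivInner B) {A : X →ₗ.[ℝ] X}
    (hdiss : ∀ x y, (x, y) ∈ A.graph → B y x ≤ 0)
    (hsurj : ∀ f, ∃ x y, (x, y) ∈ A.graph ∧ x - y = f) : Dense (A.domain : Set X) := by
  rw [Submodule.dense_iff_topologicalClosure_eq_top, Submodule.topologicalClosure_eq_top_iff,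
    Submodule.eq_bot_iff]
  intro w hw
  set z := hB.isCoercive.continuousLinearEquivOfBilin.symm w with hz
  have hzw : ∀ v, inner ℝ w v = B z v := by
    intro v
    rw [← hB.clm_apply, ← hB.isCoercive.continuousLinearEquivOfBilin_apply, hz,
      ContinuousLinearEquiv.apply_symm_apply]
  obtain ⟨x, y, hxy, e⟩ := hsurj z
  have h0 : B z x = 0 := by
    rw [← hzw]
    exact (Submodule.mem_orthogonal' _ _).1 hw x (LinearPMap.mem_domain_iff.2 ⟨y, hxy⟩)
  have h1 : B x x ≤ 0 := by
    have e1 : B z x = B x x - B y x := by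
      rw [← e]
      simp only [← hB.bilin_apply, map_sub, LinearMap.sub_apply]
    linarith [hdiss x y hxy]
  have hx := hB.eq_zero_of_self_nonpos h1
  subst hx
  have hy : y = 0 := A.graph_fst_eq_zero_snd hxy rfl
  have hz0 : z = 0 := by rw [← e, hy, sub_zero]
  rw [hz, ContinuousLinearEquiv.map_eq_zero_iff] at hz0
  exact hz0

/-- **Lumer–Phillips theorem** on a Hilbert space with an equivalent inner product. -/
theorem exists_contraction_semigroup (hB : IsEquivInner B) {A : X →ₗ.[ℝ] X}
    (hdiss : ∀ x y, (x, y) ∈ A.graph → B y x ≤ 0)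
    (hsurj : ∀ μ : ℝ, 0 < μ → ∀ f, ∃ x y, (x, y) ∈ A.graph ∧ μ • x - y = f) :
    ∃ S : ℝ≥0 → X →L[ℝ] X, IsC0Semigroup S ∧ IsGenerator A S ∧
      ∀ t z, B (S t z) (S t z) ≤ B z z := by
  have hdense : Dense (A.domain : Set X) :=
    dense_domain_of_dissipative hB hdiss fun f => by simpa using hsurj 1 one_pos f
  obtain ⟨K, hK, hKle⟩ := hB.exists_norm_le
  have hpos : ∀ n : ℕ, (0 : ℝ) < n + 1 := fun n => by positivity
  choose R hR1 hR2 hR3 using fun n : ℕ => exists_resolvent hB hdiss (hpos n) (hsurj _ (hpos n))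
  have hRnorm : ∀ n f, ‖R n f‖ ≤ K * (1 / ((n : ℝ) + 1)) * ‖f‖ := fun n f =>
    hKle _ (by positivity) _ _ (hR3 n f)
  -- The resolvent identity.
  have hres : ∀ n m f, R m f = R n f + ((n : ℝ) - m) • R n (R m f) := by
    intro n m f
    have h := hR2 n _ _ (hR1 m f)
    have e : ((n : ℝ) + 1) • R m f - (((m : ℝ) + 1) • R m f - f) = f + ((n : ℝ) - m) • R m f := by
      module
    rw [e, map_add, map_smul] at h
    exact h.symm
  have hcomm : ∀ n m, Commute (R n) (R m) := by
    intro n m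
    rcases eq_or_ne n m with rfl | hne
    · exact Commute.refl _
    have hne' : ((n : ℝ) - m) ≠ 0 := sub_ne_zero.2 (by exact_mod_cast hne)
    ext f
    have h1 := hres n m f
    have h2 := hres m n f
    have h3 : ((n : ℝ) - m) • (R n (R m f) - R m (R n f)) = 0 := by
      have e1 : ((n : ℝ) - m) • R n (R m f) = R m f - R n f := by
        rw [eq_sub_iff_add_eq, add_comm]; exact h1.symm
      have e2 : ((m : ℝ) - n) • R m (R n f) = R n f - R m f := by
        rw [eq_sub_iff_add_eq, add_comm]; exact h2.symm
      have e3 : ((n : ℝ) - m) • R m (R n f) = R m f - R n f := by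
        rw [← neg_sub (m : ℝ), neg_smul, e2, neg_sub]
      rw [smul_sub, e1, e3, sub_self]
    exact sub_eq_zero.1 ((smul_eq_zero.1 h3).resolve_left hne')
  -- The Yosida approximations `n² R(n, A) - n`.
  let T : ℕ → X →L[ℝ] X := fun n => ((n : ℝ) + 1) ^ 2 • R n - ((n : ℝ) + 1) • 1
  have hT : ∀ n m, Commute (T n) (T m) := by
    intro n m
    have h1 : Commute (R n) (T m) :=
      ((hcomm n m).smul_right _).sub_right ((Commute.one_right _).smul_right _)
    exact (h1.smul_left _).sub_left ((Commute.one_left _).smul_left _)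
  have hTdiss : ∀ n x, B (T n x) x ≤ 0 := by
    intro n x
    set μ : ℝ := (n : ℝ) + 1
    set y := R n x
    have h0 := hdiss _ _ (hR1 n x)
    set z := μ • y - x
    have e1 : T n x = μ • z := by
      simp only [T, z, sub_apply, smul_apply,
        one_apply_eq_self]
      module
    have e2 : x = μ • y - z := by simp only [z]; abel
    have e3 : B (T n x) x = μ ^ 2 * B z y - μ * B z z := by
      rw [e1, hB.smul_left]
      conv_lhs => rw [e2]
      simp only [← hB.bilin_apply, map_sub, map_smul, smul_eq_mul]
      ring
    have h1 := mul_nonneg (hpos n).le (hB.self_nonneg z)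
    have h2 := mul_nonpos_of_nonneg_of_nonpos (sq_nonneg μ) h0
    rw [e3]
    linarith
  have hexp : ∀ n s, 0 ≤ s → ∀ x, ‖expSG (T n) s x‖ ≤ K * ‖x‖ := by
    intro n s hs x
    have := hKle 1 zero_le_one _ _ (by simpa using hB.expSG_le (hTdiss n) hs x)
    simpa using this
  have hTgraph : ∀ n x y, (x, y) ∈ A.graph → T n x = ((n : ℝ) + 1) • R n y := by
    intro n x y h
    have h1 := hR2 n x y h
    rw [map_sub, map_smul, sub_eq_iff_eq_add] at h1
    simp only [T, sub_apply, smul_apply,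
      one_apply_eq_self]
    rw [sq, mul_smul, h1]
    module
  have hinv : Tendsto (fun n : ℕ => 1 / ((n : ℝ) + 1)) atTop (𝓝 0) :=
    tendsto_one_div_add_atTop_nhds_zero_nat
  have hJ : ∀ y, Tendsto (fun n : ℕ => ((n : ℝ) + 1) • R n y) atTop (𝓝 y) := by
    intro y
    have key : Tendsto (fun n : ℕ => (((n : ℝ) + 1) • R n - 1) y) atTop (𝓝 0) := by
      refine tendsto_zero_of_dense (K := K + 1) (Eventually.of_forall fun n x => ?_) hdense ?_ y
      · refine (norm_sub_le _ _).trans ?_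
        rw [add_mul, one_mul]
        refine add_le_add ?_ le_rfl
        change ‖((n : ℝ) + 1) • R n x‖ ≤ _
        rw [norm_smul, Real.norm_of_nonneg (hpos n).le]
        calc ((n : ℝ) + 1) * ‖R n x‖ ≤ ((n : ℝ) + 1) * (K * (1 / ((n : ℝ) + 1)) * ‖x‖) := by
              gcongr; exact hRnorm n x
          _ = K * ‖x‖ := by field_simp
      · intro x hx
        obtain ⟨z, hz⟩ := (LinearPMap.mem_domain_iff).1 hx
        have hb : Tendsto (fun n : ℕ => K * (1 / ((n : ℝ) + 1)) * ‖z‖) atTop (𝓝 0) := by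
          simpa using (hinv.const_mul K).mul_const ‖z‖
        refine squeeze_zero_norm (fun n => ?_) hb
        have h1 := hR2 n x z hz
        rw [map_sub, map_smul, sub_eq_iff_eq_add] at h1
        rw [sub_apply, smul_apply, h1,
          one_apply_eq_self, add_sub_cancel_left]
        exact hRnorm n z
    exact tendsto_sub_nhds_zero_iff.1 key
  have hconv : ∀ x y, (x, y) ∈ A.graph → Tendsto (fun n => T n x) atTop (𝓝 y) := by
    intro x y h
    simp only [fun n => hTgraph n x y h]
    exact hJ y
  obtain ⟨S, hS, hSlim, hSgen⟩ := exists_limit_semigroup hT hK.le hexp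
    (hdense.mono fun x hx => by
      obtain ⟨y, hy⟩ := LinearPMap.mem_domain_iff.1 hx
      exact ⟨y, hconv x y hy⟩)
  have hcontr : ∀ t z, B (S t z) (S t z) ≤ B z z := fun t z =>
    le_of_tendsto (hB.tendsto_apply (hSlim t z) (hSlim t z))
      (Eventually.of_forall fun n => hB.expSG_le (hTdiss n) t.2 z)
  refine ⟨S, hS, fun x y => ⟨fun h => hSgen x y (hconv x y h), fun h => ?_⟩, hcontr⟩
  -- The generator of `S` is a dissipative extension of `A`, and `I - A` is already onto.
  obtain ⟨x', y', hx', e⟩ := hsurj 1 one_pos (x - y)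
  rw [one_smul] at e
  have hlim := h.sub (hSgen x' y' (hconv x' y' hx'))
  have hxy : x - x' = y - y' := by
    rw [sub_eq_sub_iff_add_eq_add] at e ⊢
    rw [add_comm y x', e, add_comm]
  have hle : B (y - y') (x - x') ≤ 0 := by
    refine le_of_tendsto (hB.tendsto_apply hlim tendsto_const_nhds) ?_
    filter_upwards [self_mem_nhdsWithin] with t ht
    have ht' : (0 : ℝ) < t := by exact_mod_cast ht
    set z := x - x'
    have e1 : (t : ℝ)⁻¹ • (S t x - x) - (t : ℝ)⁻¹ • (S t x' - x') = (t : ℝ)⁻¹ • (S t z - z) := by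
      simp only [z, map_sub]
      module
    rw [e1, hB.smul_left]
    refine mul_nonpos_of_nonneg_of_nonpos (by positivity) ?_
    have h1 := hB.self_nonneg (S t z - z)
    have h2 := hcontr t z
    have e2 : B (S t z - z) (S t z - z) = B (S t z) (S t z) - 2 * B (S t z) z + B z z := by
      simp only [← hB.bilin_apply, map_sub, LinearMap.sub_apply]
      simp only [hB.bilin_apply, hB.symm z (S t z)]
      ring
    have e3 : B (S t z - z) z = B (S t z) z - B z z := by
      simp only [← hB.bilin_apply, map_sub, LinearMap.sub_apply]
    rw [e3]
    linarith
  rw [← hxy] at hle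
  have h0 : x - x' = 0 := hB.eq_zero_of_self_nonpos hle
  rw [h0] at hxy
  rwa [sub_eq_zero.1 h0, sub_eq_zero.1 hxy.symm]

end Dissipative
end Generation

/-! ### Primitives of integrable functions -/

/-- `U` is a primitive on `[a, b]` of the integrable function `f`, i.e. an absolutely continuous
function with `U' = f` almost everywhere. -/
structure IsPrimitiveOn (U f : ℝ → ℝ) (a b : ℝ) : Prop where
  integrable : IntervalIntegrable f volume a b
  eq : ∀ x ∈ Icc a b, U x = U a + ∫ s in a..x, f s

namespace IsPrimitiveOn

variable {U V f g : ℝ → ℝ} {a b : ℝ}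

theorem mono (h : IsPrimitiveOn U f a b) {c d : ℝ} (hac : a ≤ c) (hcd : c ≤ d) (hdb : d ≤ b) :
    IsPrimitiveOn U f c d := by
  have hi : ∀ x y, x ∈ Icc a b → y ∈ Icc a b → IntervalIntegrable f volume x y := fun x y hx hy =>
    h.integrable.mono_set (by
      rw [uIcc_of_le (hx.1.trans hx.2)]
      exact uIcc_subset_Icc hx hy)
  have ha : a ∈ Icc a b := ⟨le_rfl, hac.trans (hcd.trans hdb)⟩
  have hc : c ∈ Icc a b := ⟨hac, hcd.trans hdb⟩
  refine ⟨hi c d hc ⟨hac.trans hcd, hdb⟩, fun x hx => ?_⟩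
  have hx' : x ∈ Icc a b := ⟨hac.trans hx.1, hx.2.trans hdb⟩
  rw [h.eq x hx', h.eq c hc, add_assoc, intervalIntegral.integral_add_adjacent_intervals
    (hi a c ha hc) (hi c x hc hx')]

theorem absolutelyContinuous (h : IsPrimitiveOn U f a b) :
    AbsolutelyContinuousOnInterval (fun x => U a + ∫ s in a..x, f s) a b :=
  ((LipschitzWith.const (U a)).lipschitzOnWith.absolutelyContinuousOnInterval).fun_add
    (h.integrable.absolutelyContinuousOnInterval_intervalIntegral left_mem_uIcc)

theorem continuousOn (h : IsPrimitiveOn U f a b) (hab : a ≤ b) : ContinuousOn U (Icc a b) := by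
  have := h.absolutelyContinuous.continuousOn
  rw [uIcc_of_le hab] at this
  exact this.congr h.eq

theorem ae_deriv (h : IsPrimitiveOn U f a b) :
    ∀ᵐ x, x ∈ uIoc a b → deriv (fun x => U a + ∫ s in a..x, f s) x = f x := by
  filter_upwards [h.integrable.ae_hasDerivAt_integral] with x hx hx'
  exact ((hx (uIoc_subset_uIcc hx') a left_mem_uIcc).const_add (U a)).deriv

theorem integral_mul (hU : IsPrimitiveOn U f a b) (hV : IsPrimitiveOn V g a b) (hab : a ≤ b) :
    ∫ x in a..b, f x * V x + U x * g x = U b * V b - U a * V a := by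
  have h := hU.absolutelyContinuous.integral_deriv_mul_eq_sub hV.absolutelyContinuous
  simp only [intervalIntegral.integral_same, add_zero] at h
  rw [← hU.eq b ⟨hab, le_rfl⟩, ← hV.eq b ⟨hab, le_rfl⟩] at h
  rw [← h]
  refine intervalIntegral.integral_congr_ae ?_
  filter_upwards [hU.ae_deriv, hV.ae_deriv] with x h1 h2 hx
  have hx' : x ∈ Icc a b := by
    rw [uIoc_of_le hab] at hx
    exact Ioc_subset_Icc_self hx
  rw [h1 hx, h2 hx, ← hU.eq x hx', ← hV.eq x hx']

theorem mul (hU : IsPrimitiveOn U f a b) (hV : IsPrimitiveOn V g a b) (hab : a ≤ b) :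
    IsPrimitiveOn (fun x => U x * V x) (fun x => f x * V x + U x * g x) a b where
  integrable :=
    (hU.integrable.mul_continuousOn (by rw [uIcc_of_le hab]; exact hV.continuousOn hab)).add
      (hV.integrable.continuousOn_mul (by rw [uIcc_of_le hab]; exact hU.continuousOn hab))
  eq x hx := by
    rw [integral_mul (hU.mono le_rfl hx.1 hx.2) (hV.mono le_rfl hx.1 hx.2) hx.1]
    ring

theorem of_hasDerivAt (hab : a ≤ b) (h : ∀ x ∈ Icc a b, HasDerivAt U (f x) x)
    (hf : ContinuousOn f (Icc a b)) : IsPrimitiveOn U f a b where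
  integrable := by
    rw [← uIcc_of_le hab] at hf
    exact hf.intervalIntegrable
  eq x hx := by
    have hs : uIcc a x ⊆ Icc a b := by
      rw [uIcc_of_le hx.1]; exact Icc_subset_Icc_right hx.2
    rw [intervalIntegral.integral_eq_sub_of_hasDerivAt (fun y hy => h y (hs hy))
      ((hf.mono hs).intervalIntegrable)]
    ring

theorem integral {c : ℝ} (hc : c ∈ Icc a b) (hf : IntervalIntegrable f volume a b) :
    IsPrimitiveOn (fun x => ∫ s in c..x, f s) f a b where
  integrable := hf
  eq x hx := by
    have hab := hc.1.trans hc.2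
    have hi : ∀ x y, x ∈ Icc a b → y ∈ Icc a b → IntervalIntegrable f volume x y :=
      fun x y hx hy => hf.mono_set (by rw [uIcc_of_le hab]; exact uIcc_subset_Icc hx hy)
    have ha : a ∈ Icc a b := ⟨le_rfl, hab⟩
    rw [intervalIntegral.integral_add_adjacent_intervals (hi c a hc ha) (hi a x ha hx)]

end IsPrimitiveOn

/-! ### Weak derivatives and primitives -/

theorem exists_Ioo_of_isCompact {s : Set ℝ} (hs : IsCompact s) (h : s ⊆ Ioo 0 1) :
    ∃ α β : ℝ, 0 < α ∧ α < β ∧ β < 1 ∧ s ⊆ Ioo α β := by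
  rcases s.eq_empty_or_nonempty with rfl | hne
  · exact ⟨1 / 3, 2 / 3, by norm_num, by norm_num, by norm_num, empty_subset _⟩
  obtain ⟨p, hp⟩ := hs.exists_isLeast hne
  obtain ⟨q, hq⟩ := hs.exists_isGreatest hne
  have h1 := (h hp.1).1
  have h2 := (h hq.1).2
  have h3 := hp.2 hq.1
  refine ⟨p / 2, (q + 1) / 2, by linarith, by linarith, by linarith, fun x hx => ?_⟩
  have := hp.2 hx
  have := hq.2 hx
  constructor <;> linarith

theorem intervalIntegrable_of_locallyIntegrableOn {k : ℝ → ℝ}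
    (hk : LocallyIntegrableOn k (Ioo (0 : ℝ) 1)) {α β : ℝ} (h0 : 0 < α) (hαβ : α ≤ β) (h1 : β < 1) :
    IntervalIntegrable k volume α β := by
  rw [intervalIntegrable_iff_integrableOn_Icc_of_le hαβ]
  exact hk.integrableOn_compact_subset (fun x hx => ⟨h0.trans_le hx.1, hx.2.trans_lt h1⟩)
    isCompact_Icc

/-- A function which is locally a primitive of `k` has weak derivative `k`. -/
theorem isWeakDeriv_of_isPrimitiveOn {P k : ℝ → ℝ} (hk : LocallyIntegrableOn k (Ioo (0 : ℝ) 1))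
    (hP : ∀ α β, 0 < α → α ≤ β → β < 1 → IsPrimitiveOn P k α β) : IsWeakDeriv P k where
  left := by
    refine ContinuousOn.locallyIntegrableOn (fun x hx => ?_) measurableSet_Ioo
    have h := (hP (x / 2) ((x + 1) / 2) (by linarith [hx.1]) (by linarith [hx.1])
      (by linarith [hx.2])).continuousOn (by linarith [hx.1])
    exact (h.continuousAt (Icc_mem_nhds (by linarith [hx.1]) (by linarith [hx.2]))).continuousWithinAt
  right := hk
  eq φ hφ := by
    obtain ⟨α, β, h0, hαβ, h1, hs⟩ := exists_Ioo_of_isCompact hφ.2.1 hφ.2.2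
    have hφ' : IsPrimitiveOn φ (deriv φ) α β := IsPrimitiveOn.of_hasDerivAt hαβ.le
      (fun x _ => ((hφ.1.differentiable (by simp)) x).hasDerivAt)
      (hφ.1.continuous_deriv (by simp)).continuousOn
    have hPαβ := hP α β h0 hαβ.le h1
    have hz : ∀ x, x ∉ Ioo α β → φ x = 0 := fun x hx =>
      image_eq_zero_of_notMem_tsupport fun h => hx (hs h)
    have hz' : ∀ x, x ∉ Ioo α β → deriv φ x = 0 := fun x hx =>
      image_eq_zero_of_notMem_tsupport fun h => hx (hs (tsupport_deriv_subset h))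
    have hsub : Ioc α β ⊆ Ioo (0 : ℝ) 1 := fun x hx => ⟨h0.trans hx.1, hx.2.trans_lt h1⟩
    have e : ∀ F : ℝ → ℝ, (∀ x, x ∉ Ioo α β → F x = 0) →
        ∫ x in Ioo (0 : ℝ) 1, F x = ∫ x in α..β, F x := by
      intro F hF
      rw [intervalIntegral.integral_of_le hαβ.le]
      refine (setIntegral_eq_of_subset_of_forall_sdiff_eq_zero measurableSet_Ioo hsub ?_)
      exact fun x hx => hF x fun h => hx.2 (Ioo_subset_Ioc_self h)
    rw [e _ fun x hx => by rw [hz' x hx, mul_zero], e _ fun x hx => by rw [hz x hx, mul_zero]]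
    have h := hPαβ.integral_mul hφ' hαβ.le
    rw [hz α (by simp), hz β (by simp), mul_zero, mul_zero, sub_zero,
      intervalIntegral.integral_add] at h
    · linarith
    · exact hPαβ.integrable.mul_continuousOn hφ.1.continuous.continuousOn
    · refine hφ'.integrable.continuousOn_mul ?_
      rw [uIcc_of_le hαβ.le]
      exact hPαβ.continuousOn hαβ.le

/-- A function with vanishing weak derivative is constant: every test function with zero mean is
the derivative of a test function. -/
theorem IsWeakDeriv.ae_eq_const {u : ℝ → ℝ} (h : IsWeakDeriv u fun _ => 0) :
    ∃ c : ℝ, u =ᵐ[volume.restrict (Ioo (0 : ℝ) 1)] fun _ => c := by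
  let f : ContDiffBump (1 / 2 : ℝ) := ⟨1 / 8, 1 / 4, by norm_num, by norm_num⟩
  let ψ : ℝ → ℝ := f.normed volume
  have hψt : tsupport ψ = Icc (1 / 4) (3 / 4) := by
    have := f.tsupport_normed_eq (μ := volume)
    rw [Real.closedBall_eq_Icc] at this
    convert this using 2 <;> norm_num [f]
  have hψ : IsTest ψ := ⟨f.contDiff_normed, f.hasCompactSupport_normed, by
    rw [hψt]; exact Icc_subset_Ioo (by norm_num) (by norm_num)⟩
  have hψ1 : ∫ x, ψ x = 1 := f.integral_normed
  refine ⟨∫ x in Ioo (0 : ℝ) 1, u x * ψ x, ?_⟩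
  set c := ∫ x in Ioo (0 : ℝ) 1, u x * ψ x with hc
  have hloc : LocallyIntegrableOn (fun x => u x - c) (Ioo (0 : ℝ) 1) :=
    h.left.sub ((locallyIntegrable_const c).locallyIntegrableOn _)
  have key := isOpen_Ioo.ae_eq_zero_of_integral_contDiff_smul_eq_zero hloc (μ := volume) ?_
  · rw [EventuallyEq, ae_restrict_iff' measurableSet_Ioo]
    filter_upwards [key] with x hx hx'
    exact sub_eq_zero.1 (hx hx')
  intro g g1 g2 g3
  have hg : IsTest g := ⟨g1, g2, g3⟩
  set m := ∫ x, g x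
  have hgi : Integrable g := g1.continuous.integrable_of_hasCompactSupport g2
  have hψi : Integrable ψ := hψ.1.continuous.integrable_of_hasCompactSupport hψ.2.1
  let θ : ℝ → ℝ := fun x => g x - m * ψ x
  have hθs : ContDiff ℝ ∞ θ := g1.sub (contDiff_const.mul hψ.1)
  have hθi : Integrable θ := hgi.sub (hψi.const_mul m)
  have hθ0 : ∫ x, θ x = 0 := by
    rw [integral_sub hgi (hψi.const_mul m), integral_const_mul, hψ1, mul_one, sub_self]
  obtain ⟨α, β, h0, hαβ, h1, hs⟩ := exists_Ioo_of_isCompact (hg.2.1.isCompact.union hψ.2.1)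
    (union_subset g3 hψ.2.2)
  have hz : ∀ x, x ∉ Ioo α β → θ x = 0 := by
    intro x hx
    have e1 : g x = 0 := image_eq_zero_of_notMem_tsupport fun hh => hx (hs (Or.inl hh))
    have e2 : ψ x = 0 := image_eq_zero_of_notMem_tsupport fun hh => hx (hs (Or.inr hh))
    simp [θ, e1, e2]
  let φ : ℝ → ℝ := fun x => ∫ s in α..x, θ s
  have hd : ∀ x, HasDerivAt φ (θ x) x := fun x =>
    intervalIntegral.integral_hasDerivAt_right (hθs.continuous.intervalIntegrable _ _)
      (hθs.continuous.stronglyMeasurableAtFilter _ _) hθs.continuous.continuousAt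
  have hde : deriv φ = θ := funext fun x => (hd x).deriv
  have hφs : ContDiff ℝ ∞ φ := by
    rw [contDiff_infty_iff_deriv, hde]
    exact ⟨fun x => (hd x).differentiableAt, hθs⟩
  have hφsupp : Function.support φ ⊆ Icc α β := by
    intro x hx
    by_contra hxn
    apply hx
    rw [mem_Icc, not_and_or, not_le, not_le] at hxn
    rcases hxn with hlt | hgt
    · refine intervalIntegral.integral_zero_ae (Eventually.of_forall fun y hy => hz y fun hy' => ?_)
      rw [uIoc_of_ge hlt.le] at hy
      exact absurd hy'.1 (not_lt.2 hy.2)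
    · change ∫ s in α..x, θ s = 0
      rw [intervalIntegral.integral_of_le (hαβ.trans hgt).le,
        setIntegral_eq_integral_of_forall_compl_eq_zero, hθ0]
      intro y hy
      exact hz y fun hy' => hy ⟨hy'.1, hy'.2.le.trans hgt.le⟩
  have hφ : IsTest φ :=
    ⟨hφs, HasCompactSupport.of_support_subset_isCompact isCompact_Icc hφsupp,
      (closure_minimal hφsupp isClosed_Icc).trans (Icc_subset_Ioo h0 h1)⟩
  have hu := h.eq φ hφ
  rw [hde] at hu
  simp only [zero_mul, integral_zero, neg_zero] at hu
  have e1 : ∀ x, u x * θ x = u x * g x - m * (u x * ψ x) := by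
    intro x; simp only [θ]; ring
  simp only [e1] at hu
  rw [integral_sub (hg.integrableOn_mul h.left) ((hψ.integrableOn_mul h.left).const_mul m),
    integral_const_mul, ← hc] at hu
  have hz2 : ∀ x, x ∉ Ioo (0 : ℝ) 1 → g x = 0 := fun x hx =>
    image_eq_zero_of_notMem_tsupport fun hh => hx (g3 hh)
  rw [← setIntegral_eq_integral_of_forall_compl_eq_zero (s := Ioo (0 : ℝ) 1)
    fun x hx => by rw [hz2 x hx, zero_smul]]
  have e2 : ∀ x, g x • (u x - c) = u x * g x - c * g x := by
    intro x; rw [smul_eq_mul]; ring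
  simp only [e2]
  rw [integral_sub (hg.integrableOn_mul h.left) (hgi.integrableOn.const_mul c),
    integral_const_mul, setIntegral_eq_integral_of_forall_compl_eq_zero hz2]
  linarith

/-- A function with weak derivative `k` agrees almost everywhere with a primitive of `k`. -/
theorem IsWeakDeriv.exists_primitive {u k : ℝ → ℝ} (h : IsWeakDeriv u k) :
    ∃ c : ℝ, u =ᵐ[volume.restrict (Ioo (0 : ℝ) 1)] fun x => c + ∫ s in (1 / 2 : ℝ)..x, k s := by
  have hP : IsWeakDeriv (fun x => ∫ s in (1 / 2 : ℝ)..x, k s) k := by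
    refine isWeakDeriv_of_isPrimitiveOn h.right fun α β h0 hαβ h1 => ?_
    have hmin : min α (1 / 2) ≤ max β (1 / 2) := (min_le_right _ _).trans (le_max_right _ _)
    exact (IsPrimitiveOn.integral ⟨min_le_right _ _, le_max_right _ _⟩
      (intervalIntegrable_of_locallyIntegrableOn h.right (lt_min h0 (by norm_num)) hmin
        (max_lt h1 (by norm_num)))).mono (min_le_left _ _) hαβ (le_max_left _ _)
  have hd : IsWeakDeriv (fun x => u x + (-1) * ∫ s in (1 / 2 : ℝ)..x, k s) fun _ => 0 :=
    (h.add (hP.smul (-1))).congr EventuallyEq.rfl (Eventually.of_forall fun x => by simp)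
  obtain ⟨c, hc⟩ := hd.ae_eq_const
  refine ⟨c, ?_⟩
  filter_upwards [hc] with x hx
  linarith

/-! ### The Hardy inequality -/

section Hardy

variable {w : ℝ → ℝ}

theorem intervalIntegrable_of_Ioo {f : ℝ → ℝ} (hf : IntegrableOn f (Ioo 0 1)) {x y : ℝ}
    (hx : x ∈ Icc (0 : ℝ) 1) (hy : y ∈ Icc (0 : ℝ) 1) : IntervalIntegrable f volume x y := by
  have h : IntervalIntegrable f volume 0 1 :=
    (intervalIntegrable_iff_integrableOn_Ioo_of_le zero_le_one).2 hf
  exact h.mono_set (by rw [uIcc_of_le zero_le_one]; exact uIcc_subset_Icc hx hy)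

theorem integral_Ioo_eq (f : ℝ → ℝ) : ∫ x in Ioo (0 : ℝ) 1, f x = ∫ x in (0 : ℝ)..1, f x := by
  rw [intervalIntegral.integral_of_le zero_le_one, integral_Ioc_eq_integral_Ioo]

theorem sq_integral_le (h1 : IntegrableOn w (Ioo 0 1)) (h2 : IntegrableOn (fun x => w x ^ 2) (Ioo 0 1))
    {x : ℝ} (hx : x ∈ Icc (0 : ℝ) 1) :
    (∫ s in (0 : ℝ)..x, w s) ^ 2 ≤ x * ∫ s in Ioo (0 : ℝ) 1, w s ^ 2 := by
  have h0 : (0 : ℝ) ∈ Icc (0 : ℝ) 1 := by simp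
  have h01 : (1 : ℝ) ∈ Icc (0 : ℝ) 1 := by simp
  have hm : ∫ s in (0 : ℝ)..x, w s ^ 2 ≤ ∫ s in Ioo (0 : ℝ) 1, w s ^ 2 := by
    rw [integral_Ioo_eq, ← intervalIntegral.integral_add_adjacent_intervals
      (intervalIntegrable_of_Ioo h2 h0 hx) (intervalIntegrable_of_Ioo h2 hx h01)]
    have : 0 ≤ ∫ s in x..1, w s ^ 2 :=
      intervalIntegral.integral_nonneg hx.2 fun _ _ => sq_nonneg _
    linarith
  rcases hx.1.eq_or_lt with rfl | hpos
  · simp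
  set c := ∫ s in (0 : ℝ)..x, w s
  have hi1 := intervalIntegrable_of_Ioo h1 h0 hx
  have hi2 := intervalIntegrable_of_Ioo h2 h0 hx
  have h3 : 0 ≤ ∫ s in (0 : ℝ)..x, (w s ^ 2 - 2 * (c / x) * w s + (c / x) ^ 2) :=
    intervalIntegral.integral_nonneg hx.1 fun s _ => by nlinarith [sq_nonneg (w s - c / x)]
  rw [intervalIntegral.integral_add (hi2.sub (hi1.const_mul _)) intervalIntegrable_const,
    intervalIntegral.integral_sub hi2 (hi1.const_mul _), intervalIntegral.integral_const_mul,
    intervalIntegral.integral_const, smul_eq_mul] at h3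
  have h4 : c ^ 2 / x ≤ ∫ s in (0 : ℝ)..x, w s ^ 2 := by
    have e : 2 * (c / x) * c - (x - 0) * (c / x) ^ 2 = c ^ 2 / x := by
      field_simp
      ring
    linarith
  rw [div_le_iff₀ hpos] at h4
  nlinarith

/-- **Hardy's inequality** for primitives vanishing at `0` of square integrable functions. -/
theorem hardy (h1 : IntegrableOn w (Ioo 0 1)) (h2 : IntegrableOn (fun x => w x ^ 2) (Ioo 0 1)) :
    IntegrableOn (fun x => (∫ s in (0 : ℝ)..x, w s) ^ 2 / x ^ 2) (Ioo 0 1) ∧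
    ∫ x in Ioo (0 : ℝ) 1, (∫ s in (0 : ℝ)..x, w s) ^ 2 / x ^ 2 ≤
      6 * ∫ x in Ioo (0 : ℝ) 1, w x ^ 2 := by
  set U : ℝ → ℝ := fun x => ∫ s in (0 : ℝ)..x, w s with hU
  set I := ∫ x in Ioo (0 : ℝ) 1, w x ^ 2 with hI
  have h0 : (0 : ℝ) ∈ Icc (0 : ℝ) 1 := by simp
  have h01 : (1 : ℝ) ∈ Icc (0 : ℝ) 1 := by simp
  have hUp : IsPrimitiveOn U w 0 1 :=
    IsPrimitiveOn.integral h0 (intervalIntegrable_of_Ioo h1 h0 h01)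
  have hUc := hUp.continuousOn zero_le_one
  have hcont : ∀ ε : ℝ, 0 < ε → ContinuousOn (fun x => U x ^ 2 / x ^ 2) (Icc ε 1) := by
    intro ε hε
    refine ((hUc.mono (Icc_subset_Icc_left hε.le)).pow 2).div (by fun_prop) fun x hx => ?_
    have := hε.trans_le hx.1
    positivity
  -- Integrate `(U² / x)' = 2 U w / x - U² / x²` over `[ε, 1]`.
  have hbound : ∀ ε : ℝ, 0 < ε → ε ≤ 1 → ∫ x in ε..1, U x ^ 2 / x ^ 2 ≤ 6 * I := by
    intro ε hε hε1
    have hεm : ε ∈ Icc (0 : ℝ) 1 := ⟨hε.le, hε1⟩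
    have hsub : uIcc ε 1 = Icc ε 1 := uIcc_of_le hε1
    have hUε := hUp.mono hε.le hε1 le_rfl
    have hinv : IsPrimitiveOn (fun x : ℝ => x⁻¹) (fun x => -(x ^ 2)⁻¹) ε 1 :=
      IsPrimitiveOn.of_hasDerivAt hε1
        (fun x hx => hasDerivAt_inv (hε.trans_le hx.1).ne')
        (ContinuousOn.neg (ContinuousOn.inv₀ (by fun_prop) fun x hx => by
          have := hε.trans_le hx.1
          positivity))
    have hibp := (hUε.mul hUε hε1).integral_mul hinv hε1
    have hi2 : IntervalIntegrable (fun x => w x ^ 2) volume ε 1 :=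
      intervalIntegrable_of_Ioo h2 hεm h01
    have hiH : IntervalIntegrable (fun x => U x ^ 2 / x ^ 2) volume ε 1 := by
      have := hcont ε hε
      rw [← hsub] at this
      exact this.intervalIntegrable
    have hle : ∫ x in ε..1, ((w x * U x + U x * w x) * x⁻¹ + U x * U x * -(x ^ 2)⁻¹) ≤
        ∫ x in ε..1, (2 * w x ^ 2 - (1 / 2) * (U x ^ 2 / x ^ 2)) := by
      refine intervalIntegral.integral_mono_on hε1 ((hUε.mul hUε hε1).mul hinv hε1).integrable
        ((hi2.const_mul 2).sub (hiH.const_mul _)) fun x hx => ?_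
      have hxp : 0 < x := hε.trans_le hx.1
      have e : (w x * U x + U x * w x) * x⁻¹ + U x * U x * -(x ^ 2)⁻¹ =
          2 * w x * (U x / x) - (U x / x) ^ 2 := by
        field_simp
        ring
      rw [e, ← div_pow]
      nlinarith [sq_nonneg (2 * w x - U x / x)]
    rw [hibp, intervalIntegral.integral_sub (hi2.const_mul 2) (hiH.const_mul _),
      intervalIntegral.integral_const_mul, intervalIntegral.integral_const_mul] at hle
    have hw : ∫ x in ε..1, w x ^ 2 ≤ I := by
      rw [hI, integral_Ioo_eq, ← intervalIntegral.integral_add_adjacent_intervals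
        (intervalIntegrable_of_Ioo h2 h0 hεm) hi2]
      have : 0 ≤ ∫ s in (0 : ℝ)..ε, w s ^ 2 :=
        intervalIntegral.integral_nonneg hε.le fun _ _ => sq_nonneg _
      linarith
    have hUε2 : U ε * U ε * ε⁻¹ ≤ I := by
      have := sq_integral_le h1 h2 hεm
      rw [← div_eq_mul_inv, div_le_iff₀ hε]
      nlinarith
    have hU1 : 0 ≤ U 1 * U 1 * 1⁻¹ := by
      have := mul_self_nonneg (U 1)
      simpa
    linarith
  have ha : Tendsto (fun n : ℕ => 1 / ((n : ℝ) + 1)) atTop (𝓝 0) :=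
    tendsto_one_div_add_atTop_nhds_zero_nat
  have hpos : ∀ n : ℕ, 0 < 1 / ((n : ℝ) + 1) := fun n => by positivity
  have hle1 : ∀ n : ℕ, 1 / ((n : ℝ) + 1) ≤ 1 := fun n => by
    rw [div_le_one (by positivity)]
    linarith [n.cast_nonneg (α := ℝ)]
  have hint : IntegrableOn (fun x => U x ^ 2 / x ^ 2) (Ioc 0 1) := by
    refine integrableOn_Ioc_of_intervalIntegral_norm_bounded_left (I := 6 * I)
      (fun n => ((hcont _ (hpos n)).integrableOn_Icc).mono_set Ioc_subset_Icc_self) ha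
      (Eventually.of_forall fun n => ?_)
    rw [← intervalIntegral.integral_of_le (hle1 n)]
    refine le_trans (le_of_eq ?_) (hbound _ (hpos n) (hle1 n))
    refine intervalIntegral.integral_congr fun x _ => ?_
    exact Real.norm_of_nonneg (by positivity)
  refine ⟨hint.mono_set Ioo_subset_Ioc_self, ?_⟩
  rw [integral_Ioo_eq]
  have hlim : Tendsto (fun n : ℕ => ∫ x in (1 / ((n : ℝ) + 1))..1, U x ^ 2 / x ^ 2) atTop
      (𝓝 (∫ x in (0 : ℝ)..1, U x ^ 2 / x ^ 2)) := by
    have hii : IntervalIntegrable (fun x => U x ^ 2 / x ^ 2) volume 0 1 :=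
      (intervalIntegrable_iff_integrableOn_Ioc_of_le zero_le_one).2 hint
    have hc := intervalIntegral.continuousOn_primitive_interval_left
      (f := fun x => U x ^ 2 / x ^ 2) (a := 0) (b := 1) (μ := volume)
      (by rw [uIcc_of_le zero_le_one, integrableOn_Icc_iff_integrableOn_Ioc]; exact hint)
    rw [uIcc_of_le zero_le_one] at hc
    have h := (hc 0 h0).tendsto.comp (tendsto_nhdsWithin_iff.2
      ⟨ha, Eventually.of_forall fun n => ⟨(hpos n).le, hle1 n⟩⟩)
    exact h
  exact le_of_tendsto hlim (Eventually.of_forall fun n => hbound _ (hpos n) (hle1 n))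

end Hardy

/-! ### Bounds for the coefficients -/

theorem exists_bounds_of_pos {f : ℝ → ℝ} {a b : ℝ} (hab : a ≤ b) (hf : ContinuousOn f (Icc a b))
    (hpos : ∀ x ∈ Icc a b, 0 < f x) : ∃ c C : ℝ, 0 < c ∧ ∀ x ∈ Icc a b, c ≤ f x ∧ f x ≤ C := by
  have hne : (Icc a b).Nonempty := nonempty_Icc.2 hab
  obtain ⟨p, hp, hp'⟩ := isCompact_Icc.exists_isMinOn hne hf
  obtain ⟨q, hq, hq'⟩ := isCompact_Icc.exists_isMaxOn hne hf
  exact ⟨f p, f q, hpos p hp, fun x hx => ⟨hp' hx, hq' hx⟩⟩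

/-- If `x ^ K / f x` is nondecreasing near `0`, it is bounded there by one of its values; away from
`0`, compactness gives the bound. -/
theorem exists_mul_rpow_le {f : ℝ → ℝ} (hf : ContinuousOn f (Icc 0 1))
    (hpos : ∀ x ∈ Ioc (0 : ℝ) 1, 0 < f x) {K : ℝ} (hK : 0 < K)
    (hm : ∃ δ > 0, MonotoneOn (fun x : ℝ => x ^ K / f x) (Ioo 0 δ)) :
    ∃ c > 0, ∀ x ∈ Ioc (0 : ℝ) 1, c * x ^ K ≤ f x := by
  obtain ⟨δ, hδ, hm⟩ := hm
  set r := min (δ / 2) 1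
  have hr0 : 0 < r := lt_min (by linarith) one_pos
  have hr1 : r ≤ 1 := min_le_right _ _
  have hrδ : r < δ := (min_le_left _ _).trans_lt (by linarith)
  obtain ⟨m, M, hm0, hmM⟩ := exists_bounds_of_pos hr1 (hf.mono (Icc_subset_Icc_left hr0.le))
    fun x hx => hpos x ⟨hr0.trans_le hx.1, hx.2⟩
  have hA : 0 < r ^ K / f r := div_pos (Real.rpow_pos_of_pos hr0 K) (hpos r ⟨hr0, hr1⟩)
  refine ⟨min (r ^ K / f r)⁻¹ m, lt_min (inv_pos.2 hA) hm0, fun x hx => ?_⟩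
  have hxK : 0 < x ^ K := Real.rpow_pos_of_pos hx.1 K
  rcases le_total x r with h | h
  · have h1 : x ^ K / f x ≤ r ^ K / f r := hm ⟨hx.1, h.trans_lt hrδ⟩ ⟨hr0, hrδ⟩ h
    rw [div_le_iff₀ (hpos x hx)] at h1
    calc min (r ^ K / f r)⁻¹ m * x ^ K ≤ (r ^ K / f r)⁻¹ * x ^ K := by
          gcongr; exact min_le_left _ _
      _ ≤ f x := by rwa [inv_mul_le_iff₀ hA]
  · have h1 : x ^ K ≤ 1 := Real.rpow_le_one hx.1.le hx.2 hK.le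
    calc min (r ^ K / f r)⁻¹ m * x ^ K ≤ m * 1 := by
          gcongr; exact min_le_right _ _
      _ ≤ f x := by rw [mul_one]; exact (hmM x ⟨h, hx.2⟩).1

namespace Coefficients

variable (P : Coefficients)

/-- The joint degeneracy of `σ` and `d` at `0` is at most quadratic: `σ d² ≥ c x²`. This is the only
consequence of the conditions on the exponents that is needed. -/
def QuadraticBound : Prop := ∃ c > 0, ∀ x ∈ Ioc (0 : ℝ) 1, c * x ^ 2 ≤ P.sigma x * P.d x ^ 2

theorem exists_eta_bounds :
    ∃ e E : ℝ, 0 < e ∧ ∀ x ∈ Icc (0 : ℝ) 1, e ≤ P.eta x ∧ P.eta x ≤ E :=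
  exists_bounds_of_pos zero_le_one P.continuousOn_eta fun x _ => P.eta_pos x

theorem exists_d_le : ∃ D : ℝ, 0 ≤ D ∧ ∀ x ∈ Icc (0 : ℝ) 1, P.d x ≤ D := by
  obtain ⟨q, hq, hq'⟩ := isCompact_Icc.exists_isMaxOn (nonempty_Icc.2 zero_le_one) P.continuousOn_d
  refine ⟨P.d q, ?_, fun x hx => hq' hx⟩
  rw [← P.d_zero]
  exact hq' (by simp)

variable {P}

theorem HasExponents.quadraticBound {K₁ K₂ : ℝ} (hP : P.HasExponents K₁ K₂)
    (hK : K₁ + 2 * K₂ ≤ 2) : P.QuadraticBound := by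
  obtain ⟨h1, h2, m1, m2⟩ := hP
  obtain ⟨c, hc, hca⟩ := exists_mul_rpow_le P.continuousOn_a P.a_pos h1.1 m1
  obtain ⟨c', hc', hcd⟩ := exists_mul_rpow_le P.continuousOn_d P.d_pos h2.1 m2
  obtain ⟨e, E, he, hE⟩ := P.exists_eta_bounds
  have hE0 : 0 < E := he.trans_le ((hE 0 (by simp)).1.trans (hE 0 (by simp)).2)
  refine ⟨c / E * c' ^ 2, by positivity, fun x hx => ?_⟩
  have hx0 := hx.1
  have hs : c / E * x ^ K₁ ≤ P.sigma x := by
    rw [sigma, div_mul_eq_mul_div]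
    exact div_le_div₀ (P.a_pos x hx).le (hca x hx) (P.eta_pos x) (hE x (Ioc_subset_Icc_self hx)).2
  have hd : (c' * x ^ K₂) ^ 2 ≤ P.d x ^ 2 := by
    have := hcd x hx
    gcongr
  have hpow : x ^ 2 ≤ x ^ K₁ * (x ^ K₂) ^ 2 := by
    have e1 : x ^ K₁ * (x ^ K₂) ^ 2 = x ^ (K₁ + 2 * K₂) := by
      rw [Real.rpow_add hx0, mul_comm (2 : ℝ), Real.rpow_mul hx0.le, Real.rpow_two]
    rw [e1, ← Real.rpow_two]
    exact Real.rpow_le_rpow_of_exponent_ge hx0 hx.2 hK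
  calc c / E * c' ^ 2 * x ^ 2 ≤ c / E * c' ^ 2 * (x ^ K₁ * (x ^ K₂) ^ 2) := by gcongr
    _ = (c / E * x ^ K₁) * (c' * x ^ K₂) ^ 2 := by ring
    _ ≤ P.sigma x * P.d x ^ 2 :=
      mul_le_mul hs hd (by positivity) (P.sigma_pos hx).le

/-! ### Weighted `L²` spaces -/

theorem integrable_withDensity_iff {ρ : ℝ → ℝ} (hc : ContinuousOn ρ (Ioo 0 1))
    (hp : ∀ x ∈ Ioo (0 : ℝ) 1, 0 ≤ ρ x) {g : ℝ → ℝ} :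
    Integrable g ((volume.restrict (Ioo (0 : ℝ) 1)).withDensity fun x => ENNReal.ofReal (ρ x)) ↔
      IntegrableOn (fun x => ρ x * g x) (Ioo 0 1) := by
  rw [integrable_withDensity_iff_integrable_smul₀' (hc.aemeasurable measurableSet_Ioo).ennreal_ofReal
    (Eventually.of_forall fun _ => ENNReal.ofReal_lt_top)]
  refine integrable_congr ?_
  filter_upwards [ae_restrict_mem measurableSet_Ioo] with x hx
  rw [ENNReal.toReal_ofReal (hp x hx), smul_eq_mul]

theorem integral_withDensity {ρ : ℝ → ℝ} (hc : ContinuousOn ρ (Ioo 0 1))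
    (hp : ∀ x ∈ Ioo (0 : ℝ) 1, 0 ≤ ρ x) (g : ℝ → ℝ) :
    ∫ x, g x ∂((volume.restrict (Ioo (0 : ℝ) 1)).withDensity fun x => ENNReal.ofReal (ρ x)) =
      ∫ x in Ioo (0 : ℝ) 1, ρ x * g x := by
  rw [integral_withDensity_eq_integral_toReal_smul₀
    (hc.aemeasurable measurableSet_Ioo).ennreal_ofReal
    (Eventually.of_forall fun _ => ENNReal.ofReal_lt_top)]
  refine integral_congr_ae ?_
  filter_upwards [ae_restrict_mem measurableSet_Ioo] with x hx
  rw [ENNReal.toReal_ofReal (hp x hx), smul_eq_mul]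

variable (P)

theorem continuousOn_one_div_sigma : ContinuousOn (fun x => 1 / P.sigma x) (Ioc 0 1) :=
  continuousOn_const.div (P.continuousOn_sigma.mono Ioc_subset_Icc_self)
    fun _ hx => (P.sigma_pos hx).ne'

theorem integrable_sigmaMeasure_iff {g : ℝ → ℝ} :
    Integrable g P.sigmaMeasure ↔ IntegrableOn (fun x => g x / P.sigma x) (Ioo 0 1) := by
  rw [sigmaMeasure, integrable_withDensity_iff
    (P.continuousOn_one_div_sigma.mono Ioo_subset_Ioc_self)
    fun x hx => (one_div_pos.2 (P.sigma_pos (Ioo_subset_Ioc_self hx))).le]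
  simp only [one_div_mul_eq_div]

theorem integral_sigmaMeasure (g : ℝ → ℝ) :
    ∫ x, g x ∂P.sigmaMeasure = ∫ x in Ioo (0 : ℝ) 1, g x / P.sigma x := by
  rw [sigmaMeasure, integral_withDensity
    (P.continuousOn_one_div_sigma.mono Ioo_subset_Ioc_self)
    fun x hx => (one_div_pos.2 (P.sigma_pos (Ioo_subset_Ioc_self hx))).le]
  simp only [one_div_mul_eq_div]

theorem integrable_etaMeasure_iff {g : ℝ → ℝ} :
    Integrable g P.etaMeasure ↔ IntegrableOn (fun x => P.eta x * g x) (Ioo 0 1) :=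
  integrable_withDensity_iff (P.continuousOn_eta.mono Ioo_subset_Icc_self)
    fun x _ => (P.eta_pos x).le

theorem integral_etaMeasure (g : ℝ → ℝ) :
    ∫ x, g x ∂P.etaMeasure = ∫ x in Ioo (0 : ℝ) 1, P.eta x * g x :=
  integral_withDensity (P.continuousOn_eta.mono Ioo_subset_Icc_self)
    (fun x _ => (P.eta_pos x).le) g

theorem sigmaMeasure_absolutelyContinuous : P.sigmaMeasure ≪ volume.restrict (Ioo (0 : ℝ) 1) :=
  withDensity_absolutelyContinuous _ _

variable {P}

theorem L2_inner (f g : P.L2) : inner ℝ f g = ∫ x in Ioo (0 : ℝ) 1, f x * g x / P.sigma x := by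
  rw [L2.inner_def, P.integral_sigmaMeasure]
  refine integral_congr_ae (Eventually.of_forall fun x => ?_)
  simp only [RCLike.inner_apply, conj_trivial, mul_comm (g x)]

theorem L2_integrable (f g : P.L2) :
    IntegrableOn (fun x => f x * g x / P.sigma x) (Ioo 0 1) := by
  have h := P.integrable_sigmaMeasure_iff.1 (L2.integrable_inner (𝕜 := ℝ) g f)
  simpa only [RCLike.inner_apply, conj_trivial] using h

theorem L2eta_inner (f g : P.L2eta) :
    inner ℝ f g = ∫ x in Ioo (0 : ℝ) 1, P.eta x * f x * g x := by
  rw [L2.inner_def, P.integral_etaMeasure]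
  refine integral_congr_ae (Eventually.of_forall fun x => ?_)
  simp only [RCLike.inner_apply, conj_trivial, mul_comm (g x), mul_assoc]

theorem L2eta_integrable (f g : P.L2eta) :
    IntegrableOn (fun x => P.eta x * f x * g x) (Ioo 0 1) := by
  have h := P.integrable_etaMeasure_iff.1 (L2.integrable_inner (𝕜 := ℝ) g f)
  simpa only [RCLike.inner_apply, conj_trivial, mul_assoc] using h

theorem L2eta_norm_sq (f : P.L2eta) :
    ‖f‖ ^ 2 = ∫ x in Ioo (0 : ℝ) 1, P.eta x * f x ^ 2 := by
  rw [← real_inner_self_eq_norm_sq, L2eta_inner]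
  simp only [mul_assoc, sq]

theorem memLp_sigmaMeasure {f : ℝ → ℝ}
    (hf : AEStronglyMeasurable f (volume.restrict (Ioo (0 : ℝ) 1)))
    (h : IntegrableOn (fun x => f x ^ 2 / P.sigma x) (Ioo 0 1)) : MemLp f 2 P.sigmaMeasure :=
  (memLp_two_iff_integrable_sq (hf.mono_ac P.sigmaMeasure_absolutelyContinuous)).2
    (P.integrable_sigmaMeasure_iff.2 h)

theorem coeFn_toLp_sigma {f : ℝ → ℝ} (hf : MemLp f 2 P.sigmaMeasure) :
    ⇑(hf.toLp f) =ᵐ[volume.restrict (Ioo (0 : ℝ) 1)] f :=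
  P.absolutelyContinuous_sigmaMeasure.ae_le hf.coeFn_toLp

theorem L2_ext {f g : P.L2} (h : ⇑f =ᵐ[volume.restrict (Ioo (0 : ℝ) 1)] g) : f = g :=
  Lp.ext (P.sigmaMeasure_absolutelyContinuous.ae_le h)

theorem L2_aestronglyMeasurable (f : P.L2) :
    AEStronglyMeasurable f (volume.restrict (Ioo (0 : ℝ) 1)) :=
  (Lp.aestronglyMeasurable f).mono_ac P.absolutelyContinuous_sigmaMeasure

theorem L2eta_aestronglyMeasurable (f : P.L2eta) :
    AEStronglyMeasurable f (volume.restrict (Ioo (0 : ℝ) 1)) :=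
  (Lp.aestronglyMeasurable f).mono_ac P.absolutelyContinuous_etaMeasure

theorem L2eta_integrable_sq (w : P.L2eta) : IntegrableOn (fun x => w x ^ 2) (Ioo 0 1) := by
  have h : IntegrableOn (fun x => (P.eta x * w x * w x) * (P.eta x)⁻¹) (Icc 0 1) := by
    refine IntegrableOn.mul_continuousOn ?_
      (P.continuousOn_eta.inv₀ fun x _ => (P.eta_pos x).ne') isCompact_Icc
    rw [integrableOn_Icc_iff_integrableOn_Ioo]
    exact L2eta_integrable w w
  refine (h.mono_set Ioo_subset_Icc_self).congr_fun (fun x _ => ?_) measurableSet_Ioo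
  have := (P.eta_pos x).ne'
  field_simp

theorem L2eta_integrableOn (w : P.L2eta) : IntegrableOn w (Ioo 0 1) :=
  ((memLp_two_iff_integrable_sq (L2eta_aestronglyMeasurable w)).2
    (L2eta_integrable_sq w)).integrable one_le_two

variable (P) in
theorem exists_integral_sq_le :
    ∃ C : ℝ, 0 ≤ C ∧ ∀ w : P.L2eta, ∫ x in Ioo (0 : ℝ) 1, w x ^ 2 ≤ C * ‖w‖ ^ 2 := by
  obtain ⟨e, E, he, hE⟩ := P.exists_eta_bounds
  refine ⟨1 / e, by positivity, fun w => ?_⟩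
  rw [L2eta_norm_sq, ← integral_const_mul]
  have hi : IntegrableOn (fun x => P.eta x * w x ^ 2) (Ioo 0 1) := by
    simpa only [sq, mul_assoc] using L2eta_integrable w w
  refine setIntegral_mono_on (L2eta_integrable_sq w) (hi.const_mul _) measurableSet_Ioo
    fun x hx => ?_
  have h1 := (hE x (Ioo_subset_Icc_self hx)).1
  rw [← mul_assoc, one_div_mul_eq_div]
  exact le_mul_of_one_le_left (sq_nonneg _) ((one_le_div he).2 h1)

/-- `h / σ` is integrable away from `0` when `h ∈ L²_{1/σ}`. -/
theorem L2_integrableOn_div_sigma (h : P.L2) {ε : ℝ} (hε : 0 < ε) :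
    IntegrableOn (fun x => h x / P.sigma x) (Ioo ε 1) := by
  have hsub : Ioo ε 1 ⊆ Ioo (0 : ℝ) 1 := Ioo_subset_Ioo_left hε.le
  have h1 : IntegrableOn (fun x => 1 / P.sigma x) (Ioo ε 1) :=
    ((P.continuousOn_one_div_sigma.mono fun x (hx : x ∈ Icc ε 1) =>
      ⟨hε.trans_le hx.1, hx.2⟩).integrableOn_Icc).mono_set Ioo_subset_Icc_self
  have hm : AEStronglyMeasurable (fun x => h x / P.sigma x) (volume.restrict (Ioo ε 1)) := by
    have := ((L2_aestronglyMeasurable h).mono_set hsub).mul h1.aestronglyMeasurable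
    refine this.congr (Eventually.of_forall fun x => ?_)
    simp [div_eq_mul_inv]
  refine Integrable.mono' (((L2_integrable h h).mono_set hsub).add h1) hm ?_
  filter_upwards [ae_restrict_mem measurableSet_Ioo] with x hx
  have hs := P.sigma_pos (Ioo_subset_Ioc_self (hsub hx))
  rw [Real.norm_eq_abs, abs_div, abs_of_pos hs, Pi.add_apply, ← add_div]
  gcongr
  rw [← abs_mul_abs_self (h x)]
  nlinarith [sq_nonneg (|h x| - 1)]

theorem L2_locallyIntegrableOn_div_sigma (h : P.L2) :
    LocallyIntegrableOn (fun x => h x / P.sigma x) (Ioo 0 1) := by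
  rw [locallyIntegrableOn_iff isOpen_Ioo.isLocallyClosed]
  intro k hk hc
  obtain ⟨α, β, h0, -, h1, hs⟩ := exists_Ioo_of_isCompact hc hk
  exact (L2_integrableOn_div_sigma h h0).mono_set (hs.trans (Ioo_subset_Ioo_right h1.le))

/-! ### The space `H¹_{1/σ,0}` -/

theorem isPrimitiveOn_L2eta (w : P.L2eta) :
    IsPrimitiveOn (fun x => ∫ s in (0 : ℝ)..x, w s) w 0 1 :=
  IsPrimitiveOn.integral (by simp) (intervalIntegrable_of_Ioo (L2eta_integrableOn w)
    (by simp) (by simp))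

/-- The continuous representative of `u` is the primitive of `u'` that vanishes at `0`. -/
theorem rep_eq_integral (u : P.H10) {x : ℝ} (hx : x ∈ Icc (0 : ℝ) 1) :
    rep u x = ∫ s in (0 : ℝ)..x, der u s := by
  have hw : IsWeakDeriv (toL2 u) (der u) := u.2.1
  obtain ⟨c, hc⟩ := hw.exists_primitive
  have hp := isPrimitiveOn_L2eta (der u)
  have hcont := hp.continuousOn zero_le_one
  set b := ∫ s in (0 : ℝ)..(1 / 2), der u s
  have hhalf : (1 / 2 : ℝ) ∈ Icc (0 : ℝ) 1 := by constructor <;> norm_num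
  have he : EqOn (rep u) (fun x => (c - b) + ∫ s in (0 : ℝ)..x, der u s) (Icc 0 1) := by
    refine Measure.eqOn_Icc_of_ae_eq volume zero_ne_one ?_ (rep_spec u).1
      (continuousOn_const.add hcont)
    rw [← restrict_Ioo_eq_restrict_Icc]
    filter_upwards [(rep_spec u).2.1, hc, ae_restrict_mem measurableSet_Ioo] with y h1 h2 hy
    rw [← h1, h2]
    have := intervalIntegral.integral_add_adjacent_intervals
      (intervalIntegrable_of_Ioo (L2eta_integrableOn (der u)) (left_mem_Icc.2 zero_le_one) hhalf)
      (intervalIntegrable_of_Ioo (L2eta_integrableOn (der u)) hhalf (Ioo_subset_Icc_self hy))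
    rw [← this]
    ring
  have h0 := he (show (0 : ℝ) ∈ Icc (0 : ℝ) 1 by simp)
  rw [(rep_spec u).2.2] at h0
  simp only [intervalIntegral.integral_same, add_zero] at h0
  rw [he hx]
  simp only [← h0, zero_add]

theorem isPrimitiveOn_rep (u : P.H10) : IsPrimitiveOn (rep u) (der u) 0 1 where
  integrable := (isPrimitiveOn_L2eta (der u)).integrable
  eq x hx := by rw [rep_eq_integral u hx, (rep_spec u).2.2, zero_add]

/-- The weighted Hardy inequality `∫ (U / d)² / σ ≤ C ‖w‖²` for `U = ∫_0^x w`, obtained from the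
classical one through `σ d² ≥ c x²`. -/
theorem QuadraticBound.exists_hardy (hP : P.QuadraticBound) :
    ∃ C : ℝ, 0 ≤ C ∧ ∀ w : P.L2eta,
      IntegrableOn (fun x => ((∫ s in (0 : ℝ)..x, w s) / P.d x) ^ 2 / P.sigma x) (Ioo 0 1) ∧
      ∫ x in Ioo (0 : ℝ) 1, ((∫ s in (0 : ℝ)..x, w s) / P.d x) ^ 2 / P.sigma x ≤ C * ‖w‖ ^ 2 := by
  obtain ⟨c, hc, hcx⟩ := hP
  obtain ⟨C, hC, hCw⟩ := P.exists_integral_sq_le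
  refine ⟨1 / c * (6 * C), by positivity, fun w => ?_⟩
  obtain ⟨h1, h2⟩ := hardy (L2eta_integrableOn w) (L2eta_integrable_sq w)
  set U : ℝ → ℝ := fun x => ∫ s in (0 : ℝ)..x, w s
  have hUc : ContinuousOn U (Icc 0 1) := (isPrimitiveOn_L2eta w).continuousOn zero_le_one
  have hle : ∀ x ∈ Ioo (0 : ℝ) 1, (U x / P.d x) ^ 2 / P.sigma x ≤ 1 / c * (U x ^ 2 / x ^ 2) := by
    intro x hx
    have hx' := Ioo_subset_Ioc_self hx
    have hd := P.d_pos x hx'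
    have hs := P.sigma_pos hx'
    have hx0 := hx.1
    have e : 1 / c * (U x ^ 2 / x ^ 2) = U x ^ 2 / (c * x ^ 2) := by field_simp
    rw [e, div_pow, div_div]
    refine div_le_div_of_nonneg_left (sq_nonneg _) (by positivity) ?_
    rw [mul_comm (P.d x ^ 2)]
    exact hcx x hx'
  have hi : IntegrableOn (fun x => (U x / P.d x) ^ 2 / P.sigma x) (Ioo 0 1) := by
    refine Integrable.mono' (h1.const_mul (1 / c)) ?_ ?_
    · refine ContinuousOn.aestronglyMeasurable ?_ measurableSet_Ioo
      refine (((hUc.mono Ioo_subset_Icc_self).div (P.continuousOn_d.mono Ioo_subset_Icc_self)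
        fun x hx => (P.d_pos x (Ioo_subset_Ioc_self hx)).ne').pow 2).div
        (P.continuousOn_sigma.mono Ioo_subset_Icc_self)
        fun x hx => (P.sigma_pos (Ioo_subset_Ioc_self hx)).ne'
    · filter_upwards [ae_restrict_mem measurableSet_Ioo] with x hx
      rw [Real.norm_of_nonneg (div_nonneg (sq_nonneg _)
        (P.sigma_pos (Ioo_subset_Ioc_self hx)).le)]
      exact hle x hx
  refine ⟨hi, ?_⟩
  calc ∫ x in Ioo (0 : ℝ) 1, (U x / P.d x) ^ 2 / P.sigma x
      ≤ ∫ x in Ioo (0 : ℝ) 1, 1 / c * (U x ^ 2 / x ^ 2) :=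
        setIntegral_mono_on hi (h1.const_mul _) measurableSet_Ioo hle
    _ = 1 / c * ∫ x in Ioo (0 : ℝ) 1, U x ^ 2 / x ^ 2 := integral_const_mul _ _
    _ ≤ 1 / c * (6 * ∫ x in Ioo (0 : ℝ) 1, w x ^ 2) := by gcongr
    _ ≤ 1 / c * (6 * (C * ‖w‖ ^ 2)) := by gcongr; exact hCw w
    _ = 1 / c * (6 * C) * ‖w‖ ^ 2 := by ring

/-- Every `w ∈ L²(0,1)` is the derivative of an element of `H¹_{1/σ,0}`. -/
theorem QuadraticBound.exists_der_eq (hP : P.QuadraticBound) (w : P.L2eta) :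
    ∃ u : P.H10, der u = w := by
  obtain ⟨C, hC, hCw⟩ := hP.exists_hardy
  obtain ⟨D, hD0, hD⟩ := P.exists_d_le
  set U : ℝ → ℝ := fun x => ∫ s in (0 : ℝ)..x, w s with hU
  have hp := isPrimitiveOn_L2eta w
  have hUc : ContinuousOn U (Icc 0 1) := hp.continuousOn zero_le_one
  have hUm : AEStronglyMeasurable U (volume.restrict (Ioo (0 : ℝ) 1)) :=
    (hUc.mono Ioo_subset_Icc_self).aestronglyMeasurable measurableSet_Ioo
  have hi : IntegrableOn (fun x => U x ^ 2 / P.sigma x) (Ioo 0 1) := by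
    refine Integrable.mono' ((hCw w).1.const_mul (D ^ 2)) ?_ ?_
    · exact ((hUc.mono Ioo_subset_Icc_self).pow 2).div (P.continuousOn_sigma.mono
        Ioo_subset_Icc_self) (fun x hx => (P.sigma_pos (Ioo_subset_Ioc_self hx)).ne')
        |>.aestronglyMeasurable measurableSet_Ioo
    · filter_upwards [ae_restrict_mem measurableSet_Ioo] with x hx
      have hs := P.sigma_pos (Ioo_subset_Ioc_self hx)
      have hd := P.d_pos x (Ioo_subset_Ioc_self hx)
      have hdD := hD x (Ioo_subset_Icc_self hx)
      rw [Real.norm_of_nonneg (by positivity)]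
      have e : D ^ 2 * ((U x / P.d x) ^ 2 / P.sigma x) =
          (D ^ 2 / P.d x ^ 2) * (U x ^ 2 / P.sigma x) := by field_simp
      change _ ≤ D ^ 2 * ((U x / P.d x) ^ 2 / P.sigma x)
      rw [e]
      refine le_mul_of_one_le_left (by positivity) ((one_le_div (by positivity)).2 ?_)
      gcongr
  have hmem := memLp_sigmaMeasure hUm hi
  have hae := coeFn_toLp_sigma hmem
  refine ⟨⟨WithLp.toLp 2 (hmem.toLp U, w), ?_, U, hUc, hae, by simp [hU]⟩, rfl⟩
  refine (isWeakDeriv_of_isPrimitiveOn (L2eta_integrableOn w).locallyIntegrableOn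
    fun α β h0 hαβ h1 => hp.mono h0.le hαβ h1.le).congr hae.symm EventuallyEq.rfl

theorem toL2_eq_rep (u : P.H10) : ⇑(toL2 u) =ᵐ[volume.restrict (Ioo (0 : ℝ) 1)] rep u :=
  (rep_spec u).2.1

theorem norm_sq_H10 (u : P.H10) : ‖u‖ ^ 2 = ‖toL2 u‖ ^ 2 + ‖der u‖ ^ 2 :=
  WithLp.prod_norm_sq_eq_of_L2 (u : WithLp 2 (P.L2 × P.L2eta))

theorem norm_der_le (u : P.H10) : ‖der u‖ ≤ ‖u‖ := by
  refine le_of_sq_le_sq ?_ (norm_nonneg _)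
  rw [norm_sq_H10]
  linarith [sq_nonneg ‖toL2 u‖]

theorem norm_toL2_le (u : P.H10) : ‖toL2 u‖ ≤ ‖u‖ := by
  refine le_of_sq_le_sq ?_ (norm_nonneg _)
  rw [norm_sq_H10]
  linarith [sq_nonneg ‖der u‖]

variable (P) in
/-- The inclusion `H¹_{1/σ,0} → L²_{1/σ}` as a bounded operator. -/
noncomputable def toL2L : P.H10 →L[ℝ] P.L2 :=
  LinearMap.mkContinuous ⟨⟨toL2, fun _ _ => rfl⟩, fun _ _ => rfl⟩ 1
    fun u => (norm_toL2_le u).trans_eq (one_mul _).symm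

variable (P) in
/-- The derivative `H¹_{1/σ,0} → L²` as a bounded operator. -/
noncomputable def derL : P.H10 →L[ℝ] P.L2eta :=
  LinearMap.mkContinuous ⟨⟨der, fun _ _ => rfl⟩, fun _ _ => rfl⟩ 1
    fun u => (norm_der_le u).trans_eq (one_mul _).symm

@[simp] theorem derL_apply (u : P.H10) : P.derL u = der u := rfl

variable (P) in
theorem exists_rep_one_le : ∃ C : ℝ, 0 ≤ C ∧ ∀ u : P.H10, |rep u 1| ≤ C * ‖der u‖ := by
  obtain ⟨C, hC, hCw⟩ := P.exists_integral_sq_le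
  refine ⟨√C, by positivity, fun u => abs_le_of_sq_le_sq ?_ (by positivity)⟩
  rw [rep_eq_integral u (by simp), mul_pow, Real.sq_sqrt hC]
  have := sq_integral_le (L2eta_integrableOn (der u)) (L2eta_integrable_sq (der u))
    (x := 1) (by simp)
  rw [one_mul] at this
  exact this.trans (hCw _)

variable (P) in
/-- The evaluation `u ↦ u(1)` as a bounded functional on `H¹_{1/σ,0}`. -/
noncomputable def evalOne : P.H10 →L[ℝ] ℝ :=
  LinearMap.mkContinuous ⟨⟨fun u => rep u 1, fun u v => rep_add u v (by simp)⟩,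
    fun c u => rep_smul c u (by simp)⟩ P.exists_rep_one_le.choose fun u =>
      (P.exists_rep_one_le.choose_spec.2 u).trans
        (mul_le_mul_of_nonneg_left (norm_der_le u) P.exists_rep_one_le.choose_spec.1)

@[simp] theorem evalOne_apply (u : P.H10) : P.evalOne u = rep u 1 := rfl

theorem QuadraticBound.exists_integrable_div (hP : P.QuadraticBound) :
    ∃ C : ℝ, 0 ≤ C ∧ ∀ u : P.H10,
      IntegrableOn (fun x => (rep u x / P.d x) ^ 2 / P.sigma x) (Ioo 0 1) ∧
      ∫ x in Ioo (0 : ℝ) 1, (rep u x / P.d x) ^ 2 / P.sigma x ≤ C * ‖der u‖ ^ 2 := by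
  obtain ⟨C, hC, h⟩ := hP.exists_hardy
  refine ⟨C, hC, fun u => ?_⟩
  have he : EqOn (fun x => ((∫ s in (0 : ℝ)..x, der u s) / P.d x) ^ 2 / P.sigma x)
      (fun x => (rep u x / P.d x) ^ 2 / P.sigma x) (Ioo 0 1) := fun x hx => by
    simp only [rep_eq_integral u (Ioo_subset_Icc_self hx)]
  exact ⟨(h (der u)).1.congr_fun he measurableSet_Ioo,
    (setIntegral_congr_fun measurableSet_Ioo he) ▸ (h (der u)).2⟩

theorem QuadraticBound.memLp_div (hP : P.QuadraticBound) (u : P.H10) :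
    MemLp (fun x => rep u x / P.d x) 2 P.sigmaMeasure := by
  obtain ⟨C, hC, h⟩ := hP.exists_integrable_div
  refine memLp_sigmaMeasure (ContinuousOn.aestronglyMeasurable ?_ measurableSet_Ioo) (h u).1
  exact ((rep_spec u).1.mono Ioo_subset_Icc_self).div (P.continuousOn_d.mono Ioo_subset_Icc_self)
    fun x hx => (P.d_pos x (Ioo_subset_Ioc_self hx)).ne'

theorem L2_norm_sq (f : P.L2) : ‖f‖ ^ 2 = ∫ x in Ioo (0 : ℝ) 1, f x ^ 2 / P.sigma x := by
  rw [← real_inner_self_eq_norm_sq, L2_inner]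
  simp only [sq]

theorem QuadraticBound.exists_norm_div_le (hP : P.QuadraticBound) :
    ∃ C : ℝ, 0 ≤ C ∧ ∀ u : P.H10, ‖(hP.memLp_div u).toLp _‖ ≤ C * ‖der u‖ := by
  obtain ⟨C, hC, h⟩ := hP.exists_integrable_div
  refine ⟨√C, by positivity, fun u => le_of_sq_le_sq ?_ (by positivity)⟩
  rw [L2_norm_sq, mul_pow, Real.sq_sqrt hC]
  refine le_trans (le_of_eq (integral_congr_ae ?_)) (h u).2
  filter_upwards [coeFn_toLp_sigma (hP.memLp_div u)] with x hx
  rw [hx]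

/-- The bounded operator `u ↦ u / d` from `H¹_{1/σ,0}` to `L²_{1/σ}`. -/
noncomputable def divD (hP : P.QuadraticBound) : P.H10 →L[ℝ] P.L2 :=
  LinearMap.mkContinuous
    { toFun := fun u => (hP.memLp_div u).toLp _
      map_add' := fun u v => L2_ext <| by
        filter_upwards [coeFn_toLp_sigma (hP.memLp_div u), coeFn_toLp_sigma (hP.memLp_div v),
          coeFn_toLp_sigma (hP.memLp_div (u + v)),
          P.L2_add ((hP.memLp_div u).toLp _) ((hP.memLp_div v).toLp _),
          ae_restrict_mem measurableSet_Ioo] with x h1 h2 h3 h4 hx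
        rw [h3, h4, h1, h2, rep_add u v (Ioo_subset_Icc_self hx), add_div]
      map_smul' := fun c u => L2_ext <| by
        filter_upwards [coeFn_toLp_sigma (hP.memLp_div u),
          coeFn_toLp_sigma (hP.memLp_div (c • u)), P.L2_smul c ((hP.memLp_div u).toLp _),
          ae_restrict_mem measurableSet_Ioo] with x h1 h2 h3 hx
        rw [h2, RingHom.id_apply, h3, h1, rep_smul c u (Ioo_subset_Icc_self hx), mul_div_assoc] }
    hP.exists_norm_div_le.choose fun u =>
      (hP.exists_norm_div_le.choose_spec.2 u).trans
        (mul_le_mul_of_nonneg_left (norm_der_le u) hP.exists_norm_div_le.choose_spec.1)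

theorem coeFn_divD (hP : P.QuadraticBound) (u : P.H10) :
    ⇑(divD hP u) =ᵐ[volume.restrict (Ioo (0 : ℝ) 1)] fun x => rep u x / P.d x :=
  coeFn_toLp_sigma (hP.memLp_div u)

theorem exists_norm_divD_le (hP : P.QuadraticBound) :
    ∃ C : ℝ, 0 ≤ C ∧ ∀ u : P.H10, ‖divD hP u‖ ≤ C * ‖der u‖ := hP.exists_norm_div_le

theorem exists_norm_toL2_le (hP : P.QuadraticBound) :
    ∃ C : ℝ, 0 ≤ C ∧ ∀ u : P.H10, ‖toL2 u‖ ≤ C * ‖der u‖ := by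
  obtain ⟨C, hC, h⟩ := exists_norm_divD_le hP
  obtain ⟨D, hD0, hD⟩ := P.exists_d_le
  refine ⟨D * C, by positivity, fun u => ?_⟩
  have h1 : ‖toL2 u‖ ≤ D * ‖divD hP u‖ := by
    refine le_of_sq_le_sq ?_ (by positivity)
    rw [mul_pow, L2_norm_sq, L2_norm_sq, ← integral_const_mul]
    have hi : ∀ f : P.L2, IntegrableOn (fun x => f x ^ 2 / P.sigma x) (Ioo 0 1) := fun f => by
      simpa only [sq] using L2_integrable f f
    refine integral_mono_ae (hi _) ((hi _).const_mul _) ?_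
    filter_upwards [toL2_eq_rep u, coeFn_divD hP u, ae_restrict_mem measurableSet_Ioo]
      with x h1 h2 hx
    have hs := P.sigma_pos (Ioo_subset_Ioc_self hx)
    have hd := P.d_pos x (Ioo_subset_Ioc_self hx)
    have hdD := hD x (Ioo_subset_Icc_self hx)
    rw [h1, h2]
    have e : D ^ 2 * ((rep u x / P.d x) ^ 2 / P.sigma x) =
        (D ^ 2 / P.d x ^ 2) * (rep u x ^ 2 / P.sigma x) := by field_simp
    rw [e]
    refine le_mul_of_one_le_left (by positivity) ((one_le_div (by positivity)).2 ?_)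
    gcongr
  calc ‖toL2 u‖ ≤ D * ‖divD hP u‖ := h1
    _ ≤ D * (C * ‖der u‖) := by gcongr; exact h u
    _ = D * C * ‖der u‖ := by ring

theorem exists_norm_le_der (hP : P.QuadraticBound) :
    ∃ C : ℝ, 0 ≤ C ∧ ∀ u : P.H10, ‖u‖ ^ 2 ≤ C * ‖der u‖ ^ 2 := by
  obtain ⟨C, hC, h⟩ := exists_norm_toL2_le hP
  refine ⟨C ^ 2 + 1, by positivity, fun u => ?_⟩
  have := pow_le_pow_left₀ (norm_nonneg _) (h u) 2
  rw [norm_sq_H10]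
  linarith

/-- `H¹_{1/σ,0}` is complete, as `u ↦ u'` is an isomorphism onto `L²`. -/
theorem completeSpace_H10 (hP : P.QuadraticBound) : CompleteSpace P.H10 := by
  obtain ⟨C, hC, h⟩ := exists_norm_le_der hP
  have hanti : AntilipschitzWith ⟨√C, Real.sqrt_nonneg _⟩ P.derL := by
    refine ContinuousLinearMap.antilipschitz_of_bound _ fun u => ?_
    change ‖u‖ ≤ √C * ‖der u‖
    refine le_of_sq_le_sq ?_ (by positivity)
    rw [mul_pow, Real.sq_sqrt hC]
    exact h u
  have hsurj : Function.Surjective P.derL := hP.exists_der_eq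
  rw [completeSpace_iff_isComplete_range (hanti.isUniformInducing P.derL.uniformContinuous),
    hsurj.range_eq, ← completeSpace_iff_isComplete_univ]
  infer_instance

end Coefficients

/-! ### Boundary values at the degenerate end point -/

/-- If `g` is square integrable near `0` and `v² = O(x)`, then a limit of `g v` at `0` must vanish,
since otherwise `g² ≥ c / x`. -/
theorem eq_zero_of_tendsto_mul {g v : ℝ → ℝ} {C L : ℝ}
    (hg : IntegrableOn (fun x => g x ^ 2) (Ioo 0 1)) (hv : ∀ x ∈ Ioo (0 : ℝ) 1, v x ^ 2 ≤ C * x)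
    (h : Tendsto (fun x => g x * v x) (𝓝[>] 0) (𝓝 L)) : L = 0 := by
  by_contra hL
  have hL2 : 0 < L ^ 2 := by positivity
  have hev : ∀ᶠ x in 𝓝[>] (0 : ℝ), L ^ 2 / 2 < (g x * v x) ^ 2 :=
    (h.pow 2).eventually (lt_mem_nhds (by linarith))
  obtain ⟨δ', hδ', hδ⟩ := mem_nhdsGT_iff_exists_Ioo_subset.1 hev
  set δ := min δ' 1
  have hδ0 : 0 < δ := lt_min hδ' one_pos
  have hsub : Ioo 0 δ ⊆ Ioo (0 : ℝ) 1 := Ioo_subset_Ioo_right (min_le_right _ _)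
  have hinv : IntegrableOn (fun x : ℝ => x⁻¹) (Ioo 0 δ) := by
    refine Integrable.mono' ((hg.mono_set hsub).const_mul (2 * C / L ^ 2))
      (measurable_inv.aestronglyMeasurable) ?_
    filter_upwards [ae_restrict_mem measurableSet_Ioo] with x hx
    have hx0 : 0 < x := hx.1
    have h1 : L ^ 2 / 2 < (g x * v x) ^ 2 := hδ ⟨hx.1, hx.2.trans_le (min_le_left _ _)⟩
    have h2 := hv x (hsub hx)
    rw [Real.norm_of_nonneg (by positivity), inv_le_iff_one_le_mul₀ hx0, div_mul_eq_mul_div,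
      div_mul_eq_mul_div, one_le_div hL2]
    have h3 : g x ^ 2 * v x ^ 2 ≤ g x ^ 2 * (C * x) := by gcongr
    rw [mul_pow] at h1
    linarith
  have hii : IntervalIntegrable (fun x : ℝ => x⁻¹) volume 0 δ :=
    (intervalIntegrable_iff_integrableOn_Ioo_of_le hδ0.le).2 hinv
  rw [intervalIntegrable_inv_iff] at hii
  rcases hii with h' | h'
  · exact hδ0.ne h'
  · exact h' left_mem_uIcc

namespace Coefficients

variable {P : Coefficients}

/-! ### The energy inner product -/

theorem inner_divD_toL2 (hP : P.QuadraticBound) (u v : P.H10) :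
    inner ℝ (divD hP u) (toL2 v) =
      ∫ x in Ioo (0 : ℝ) 1, rep u x * rep v x / (P.sigma x * P.d x) := by
  rw [L2_inner]
  refine integral_congr_ae ?_
  filter_upwards [coeFn_divD hP u, toL2_eq_rep v] with x h1 h2
  rw [h1, h2, div_mul_eq_mul_div, div_div, mul_comm (P.d x)]

theorem integrableOn_rep_mul_rep (hP : P.QuadraticBound) (u v : P.H10) :
    IntegrableOn (fun x => rep u x * rep v x / (P.sigma x * P.d x)) (Ioo 0 1) := by
  refine (L2_integrable (divD hP u) (toL2 v)).congr ?_
  filter_upwards [coeFn_divD hP u, toL2_eq_rep v] with x h1 h2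
  rw [h1, h2, div_mul_eq_mul_div, div_div, mul_comm (P.d x)]

theorem inner_divD_toL2_comm (hP : P.QuadraticBound) (u v : P.H10) :
    inner ℝ (divD hP u) (toL2 v) = inner ℝ (divD hP v) (toL2 u) := by
  rw [inner_divD_toL2, inner_divD_toL2]
  simp only [mul_comm (rep u _)]

theorem inner_divD_toL2_self_nonneg (hP : P.QuadraticBound) (u : P.H10) :
    0 ≤ inner ℝ (divD hP u) (toL2 u) := by
  rw [inner_divD_toL2]
  refine setIntegral_nonneg measurableSet_Ioo fun x hx => ?_
  have := P.sigma_pos (Ioo_subset_Ioc_self hx)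
  have := P.d_pos x (Ioo_subset_Ioc_self hx)
  have := mul_self_nonneg (rep u x)
  positivity

theorem exists_inner_divD_toL2_le (hP : P.QuadraticBound) :
    ∃ C : ℝ, 0 < C ∧ ∀ u : P.H10, inner ℝ (divD hP u) (toL2 u) ≤ C * ‖der u‖ ^ 2 := by
  obtain ⟨C, hC, h⟩ := exists_norm_divD_le hP
  obtain ⟨C', hC', h'⟩ := exists_norm_toL2_le hP
  refine ⟨C * C' + 1, by positivity, fun u => ?_⟩
  calc inner ℝ (divD hP u) (toL2 u) ≤ ‖divD hP u‖ * ‖toL2 u‖ := real_inner_le_norm _ _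
    _ ≤ (C * ‖der u‖) * (C' * ‖der u‖) :=
      mul_le_mul (h u) (h' u) (norm_nonneg _) (by positivity)
    _ ≤ (C * C' + 1) * ‖der u‖ ^ 2 := by nlinarith [sq_nonneg ‖der u‖]

/-- The Hardy–Poincaré inequality holds with the best constant. -/
theorem inner_divD_toL2_le_hardyConst (hP : P.QuadraticBound) (u : P.H10) :
    inner ℝ (divD hP u) (toL2 u) ≤ P.hardyConst * ‖der u‖ ^ 2 := by
  have hset : ∀ C, (∀ u : P.H10,
      IntegrableOn (fun x => rep u x ^ 2 / (P.sigma x * P.d x)) (Ioo 0 1) ∧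
      ∫ x in Ioo (0 : ℝ) 1, rep u x ^ 2 / (P.sigma x * P.d x) ≤
        C * ∫ x in Ioo (0 : ℝ) 1, P.eta x * der u x ^ 2) ↔
      ∀ u : P.H10, inner ℝ (divD hP u) (toL2 u) ≤ C * ‖der u‖ ^ 2 := by
    intro C
    refine forall_congr' fun u => ?_
    have hi := integrableOn_rep_mul_rep hP u u
    rw [inner_divD_toL2, L2eta_norm_sq]
    simp only [← sq] at hi ⊢
    exact and_iff_right hi
  obtain ⟨C₀, hC₀, h₀⟩ := exists_inner_divD_toL2_le hP
  rw [hardyConst]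
  simp only [hset]
  rcases (norm_nonneg (der u)).eq_or_lt with h | h
  · have := h₀ u
    rw [← h] at this ⊢
    simpa using this
  · rw [← div_le_iff₀ (by positivity)]
    refine le_csInf ⟨C₀, hC₀, h₀⟩ fun C hC => ?_
    rw [div_le_iff₀ (by positivity)]
    exact hC.2 u

/-- Coercivity of the stiffness form below the Hardy threshold. -/
theorem exists_coercive (hP : P.QuadraticBound) {lam : ℝ} (hlam : lam < 1 / P.hardyConst) :
    ∃ m : ℝ, 0 < m ∧ ∀ u : P.H10,
      m * ‖der u‖ ^ 2 ≤ ‖der u‖ ^ 2 - lam * inner ℝ (divD hP u) (toL2 u) := by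
  rcases le_or_gt lam 0 with h | h
  · refine ⟨1, one_pos, fun u => ?_⟩
    have := mul_nonpos_of_nonpos_of_nonneg h (inner_divD_toL2_self_nonneg hP u)
    linarith
  · have hpos : 0 < P.hardyConst := one_div_pos.1 (h.trans hlam)
    rw [lt_div_iff₀ hpos] at hlam
    refine ⟨1 - lam * P.hardyConst, by linarith, fun u => ?_⟩
    have := mul_le_mul_of_nonneg_left (inner_divD_toL2_le_hardyConst hP u) h.le
    linarith

theorem energyInner_eq (hP : P.QuadraticBound) (lam β : ℝ) (y z : P.Phase) :
    P.energyInner lam β y z = inner ℝ (der y.fst) (der z.fst) + inner ℝ y.snd z.snd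
      - lam * inner ℝ (divD hP y.fst) (toL2 z.fst) + β * rep y.fst 1 * rep z.fst 1 := by
  rw [energyInner, L2eta_inner, L2_inner, inner_divD_toL2]

theorem norm_sq_phase (z : P.Phase) : ‖z‖ ^ 2 = ‖z.fst‖ ^ 2 + ‖z.snd‖ ^ 2 :=
  WithLp.prod_norm_sq_eq_of_L2 z

theorem isEquivInner_energyInner (hP : P.QuadraticBound) {lam β : ℝ}
    (hlam : lam < 1 / P.hardyConst) (hβ : 0 ≤ β) : IsEquivInner (P.energyInner lam β) where
  symm y z := by
    rw [energyInner_eq hP, energyInner_eq hP, inner_divD_toL2_comm hP, real_inner_comm,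
      real_inner_comm z.snd]
    ring
  add_left x y z := by
    simp only [energyInner_eq hP, WithLp.add_fst, WithLp.add_snd, ← derL_apply, ← evalOne_apply,
      map_add, inner_add_left]
    ring
  smul_left c x y := by
    simp only [energyInner_eq hP, WithLp.smul_fst, WithLp.smul_snd, ← derL_apply, ← evalOne_apply,
      map_smul, real_inner_smul_left, smul_eq_mul]
    ring
  equiv := by
    obtain ⟨m, hm, hco⟩ := exists_coercive hP hlam
    obtain ⟨C, hC, hCu⟩ := exists_norm_le_der hP
    obtain ⟨C₁, hC₁, h₁⟩ := exists_norm_divD_le hP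
    obtain ⟨C₂, hC₂, h₂⟩ := exists_norm_toL2_le hP
    obtain ⟨C₃, hC₃, h₃⟩ := P.exists_rep_one_le
    refine ⟨min (m / (C + 1)) 1, 1 + |lam| * (C₁ * C₂) + β * C₃ ^ 2, by positivity,
      fun z => ⟨?_, ?_⟩⟩
    · rw [energyInner_eq hP, norm_sq_phase, real_inner_self_eq_norm_sq,
        real_inner_self_eq_norm_sq]
      have h1 := hco z.fst
      have h2 : m / (C + 1) * ‖z.fst‖ ^ 2 ≤ m * ‖der z.fst‖ ^ 2 := by
        rw [div_mul_eq_mul_div, div_le_iff₀ (by positivity), mul_assoc]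
        have := hCu z.fst
        have h3 := sq_nonneg ‖der z.fst‖
        gcongr
        linarith
      have h3 : min (m / (C + 1)) 1 * ‖z.fst‖ ^ 2 ≤ m / (C + 1) * ‖z.fst‖ ^ 2 := by
        gcongr; exact min_le_left _ _
      have h4 : min (m / (C + 1)) 1 * ‖z.snd‖ ^ 2 ≤ 1 * ‖z.snd‖ ^ 2 := by
        gcongr; exact min_le_right _ _
      have h5 : 0 ≤ β * rep z.fst 1 * rep z.fst 1 := by
        rw [mul_assoc]
        exact mul_nonneg hβ (mul_self_nonneg _)
      linarith
    · rw [energyInner_eq hP, real_inner_self_eq_norm_sq, real_inner_self_eq_norm_sq]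
      set n := ‖der z.fst‖
      have hn : n ^ 2 ≤ ‖z.fst‖ ^ 2 := by
        have := norm_der_le z.fst
        gcongr
      have h1 : -(lam * inner ℝ (divD hP z.fst) (toL2 z.fst)) ≤ |lam| * (C₁ * C₂) * n ^ 2 := by
        refine (neg_le_abs _).trans ?_
        rw [abs_mul, mul_assoc]
        gcongr
        calc |inner ℝ (divD hP z.fst) (toL2 z.fst)| ≤ ‖divD hP z.fst‖ * ‖toL2 z.fst‖ :=
              abs_real_inner_le_norm _ _
          _ ≤ (C₁ * n) * (C₂ * n) :=
              mul_le_mul (h₁ _) (h₂ _) (norm_nonneg _) (by positivity)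
          _ = C₁ * C₂ * n ^ 2 := by ring
      have h2 : β * rep z.fst 1 * rep z.fst 1 ≤ β * C₃ ^ 2 * n ^ 2 := by
        rw [mul_assoc, mul_assoc, ← mul_pow, ← abs_mul_abs_self, ← sq]
        have := h₃ z.fst
        gcongr
      have h3 : n ^ 2 ≤ ‖z‖ ^ 2 := by
        rw [norm_sq_phase]; linarith [sq_nonneg ‖z.snd‖]
      have h4 : n ^ 2 + ‖z.snd‖ ^ 2 ≤ ‖z‖ ^ 2 := by
        rw [norm_sq_phase]; linarith
      have h5 : (|lam| * (C₁ * C₂) + β * C₃ ^ 2) * n ^ 2 ≤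
          (|lam| * (C₁ * C₂) + β * C₃ ^ 2) * ‖z‖ ^ 2 := by gcongr
      linarith

/-! ### Green's formula -/

/-- The flux `η u'` of `u ∈ D(A)` has a representative `G` that is absolutely continuous away
from `0`, with derivative `A u / σ`. -/
theorem IsA.exists_flux {u : P.H10} {h : P.L2} (hu : IsA u h) :
    ∃ G : ℝ → ℝ, (fun x => P.eta x * der u x) =ᵐ[volume.restrict (Ioo (0 : ℝ) 1)] G ∧
      ∀ ε, 0 < ε → ε ≤ 1 → IsPrimitiveOn G (fun x => h x / P.sigma x) ε 1 := by
  obtain ⟨c, hc⟩ := IsWeakDeriv.exists_primitive hu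
  refine ⟨_, hc, fun ε hε hε1 => ?_⟩
  have hm0 : 0 < min ε (1 / 2) := lt_min hε (by norm_num)
  have hm1 : min ε (1 / 2) ≤ 1 := (min_le_left _ _).trans hε1
  have hp : IsPrimitiveOn (fun x => ∫ s in (1 / 2 : ℝ)..x, h s / P.sigma s)
      (fun x => h x / P.sigma x) (min ε (1 / 2)) 1 :=
    IsPrimitiveOn.integral ⟨min_le_right _ _, by norm_num⟩
      ((intervalIntegrable_iff_integrableOn_Ioo_of_le hm1).2 (L2_integrableOn_div_sigma h hm0))
  have hp' := hp.mono (min_le_left _ _) hε1 le_rfl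
  refine ⟨hp'.integrable, fun x hx => ?_⟩
  have := hp'.eq x hx
  rw [this]
  ring

/-- **Green's formula** for `A`: the one-sided derivative `q = u'(1)` exists for `u ∈ D(A)`, and
`∫ η u' v' + ∫ (A u) v / σ = η(1) u'(1) v(1)`. There is no boundary term at `0`. -/
theorem IsA.green {u : P.H10} {h : P.L2} (hu : IsA u h) :
    ∃ q : ℝ, HasDerivWithinAt (rep u) q (Icc 0 1) 1 ∧ ∀ v : P.H10,
      inner ℝ (der u) (der v) + inner ℝ h (toL2 v) = P.eta 1 * q * rep v 1 := by
  obtain ⟨G, hG, hprim⟩ := hu.exists_flux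
  have hη1 : P.eta 1 ≠ 0 := (P.eta_pos 1).ne'
  refine ⟨G 1 / P.eta 1, ?_, fun v => ?_⟩
  · have hGc : ContinuousOn (fun x => G x / P.eta x) (Icc (1 / 2) 1) :=
      ((hprim (1 / 2) (by norm_num) (by norm_num)).continuousOn (by norm_num)).div
        (P.continuousOn_eta.mono (Icc_subset_Icc_left (by norm_num))) fun x _ => (P.eta_pos x).ne'
    have hnhds : Icc (1 / 2 : ℝ) 1 ∈ 𝓝[≤] (1 : ℝ) := Icc_mem_nhdsLE (by norm_num)
    have hii : IntervalIntegrable (fun x => G x / P.eta x) volume (1 / 2) 1 := by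
      rw [← uIcc_of_le (by norm_num : (1 / 2 : ℝ) ≤ 1)] at hGc
      exact hGc.intervalIntegrable
    have hder : HasDerivWithinAt (fun x => ∫ s in (1 / 2 : ℝ)..x, G s / P.eta s) (G 1 / P.eta 1)
        (Iic 1) 1 := by
      refine intervalIntegral.integral_hasDerivWithinAt_right hii (t := Iic 1) ?_ ?_
      · exact ⟨_, hnhds, hGc.aestronglyMeasurable measurableSet_Icc⟩
      · exact (hGc 1 (by constructor <;> norm_num)).mono_of_mem_nhdsWithin hnhds
    have heq : ∀ x ∈ Icc (1 / 2 : ℝ) 1,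
        rep u x = rep u (1 / 2) + ∫ s in (1 / 2 : ℝ)..x, G s / P.eta s := by
      intro x hx
      rw [((isPrimitiveOn_rep u).mono (c := 1 / 2) (by norm_num) (by norm_num) le_rfl).eq x hx]
      congr 1
      refine intervalIntegral.integral_congr_ae_restrict ?_
      have hsub : uIoc (1 / 2) x ⊆ Ioc 0 1 := by
        rw [uIoc_of_le hx.1]
        exact Ioc_subset_Ioc (by norm_num) hx.2
      refine ae_restrict_of_ae_restrict_of_subset hsub ?_
      rw [← restrict_Ioo_eq_restrict_Ioc]
      filter_upwards [hG] with s hs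
      have := (P.eta_pos s).ne'
      rw [← hs]
      field_simp
    have h1 : (1 : ℝ) ∈ Icc (1 / 2 : ℝ) 1 := by constructor <;> norm_num
    have h2 : HasDerivWithinAt (rep u) (G 1 / P.eta 1) (Iic 1) 1 := by
      refine (hder.const_add (rep u (1 / 2))).congr_of_eventuallyEq ?_ (heq 1 h1)
      filter_upwards [hnhds] with x hx using heq x hx
    exact h2.mono Icc_subset_Iic_self
  · set F : ℝ → ℝ := fun x => P.eta x * der u x * der v x + h x * toL2 v x / P.sigma x with hF
    have hFi : IntegrableOn F (Ioo 0 1) := (L2eta_integrable _ _).add (L2_integrable _ _)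
    have hFint : ∫ x in (0 : ℝ)..1, F x = inner ℝ (der u) (der v) + inner ℝ h (toL2 v) := by
      rw [← integral_Ioo_eq, L2eta_inner, L2_inner]
      exact integral_add (L2eta_integrable _ _) (L2_integrable _ _)
    -- Integration by parts on `[x, 1]`.
    have hibp : ∀ x ∈ Ioo (0 : ℝ) 1, G x * rep v x = G 1 * rep v 1 - ∫ s in x..1, F s := by
      intro x hx
      have h1 := (hprim x hx.1 hx.2.le).integral_mul
        ((isPrimitiveOn_rep v).mono hx.1.le hx.2.le le_rfl) hx.2.le
      have h2 : ∫ s in x..1, F s = ∫ s in x..1, (h s / P.sigma s * rep v s + G s * der v s) := by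
        refine intervalIntegral.integral_congr_ae_restrict ?_
        have hsub : uIoc x 1 ⊆ Ioc 0 1 := by
          rw [uIoc_of_le hx.2.le]
          exact Ioc_subset_Ioc_left hx.1.le
        refine ae_restrict_of_ae_restrict_of_subset hsub ?_
        rw [← restrict_Ioo_eq_restrict_Ioc]
        filter_upwards [hG, toL2_eq_rep v] with s h1 h2
        simp only [hF]
        rw [h1, h2]
        ring
      rw [h2, h1]
      ring
    have hii : IntervalIntegrable F volume 0 1 :=
      (intervalIntegrable_iff_integrableOn_Ioo_of_le zero_le_one).2 hFi
    have hlim : Tendsto (fun x => G x * rep v x) (𝓝[>] 0)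
        (𝓝 (G 1 * rep v 1 - ∫ s in (0 : ℝ)..1, F s)) := by
      have hc := intervalIntegral.continuousOn_primitive_interval_left
        (f := F) (a := 0) (b := 1) (μ := volume)
        (by rw [uIcc_of_le zero_le_one, integrableOn_Icc_iff_integrableOn_Ioo]; exact hFi)
      rw [uIcc_of_le zero_le_one] at hc
      have h0 := (hc 0 (by simp)).mono Ioo_subset_Icc_self
      have h1 : Tendsto (fun x => ∫ s in x..1, F s) (𝓝[>] 0) (𝓝 (∫ s in (0 : ℝ)..1, F s)) := by
        rw [← nhdsWithin_Ioo_eq_nhdsGT one_pos]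
        exact h0
      refine (h1.const_sub (G 1 * rep v 1)).congr' ?_
      filter_upwards [Ioo_mem_nhdsGT (one_pos : (0 : ℝ) < 1)] with x hx
      exact (hibp x hx).symm
    have hGsq : IntegrableOn (fun x => G x ^ 2) (Ioo 0 1) := by
      have h1 : IntegrableOn (fun x => der u x ^ 2 * P.eta x ^ 2) (Icc 0 1) :=
        IntegrableOn.mul_continuousOn
          (by rw [integrableOn_Icc_iff_integrableOn_Ioo]; exact L2eta_integrable_sq (der u))
          (P.continuousOn_eta.pow 2) isCompact_Icc
      refine (h1.mono_set Ioo_subset_Icc_self).congr ?_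
      filter_upwards [hG] with x hx
      rw [← hx]
      ring
    have hvle : ∀ x ∈ Ioo (0 : ℝ) 1, rep v x ^ 2 ≤ (∫ s in Ioo (0 : ℝ) 1, der v s ^ 2) * x := by
      intro x hx
      rw [rep_eq_integral v (Ioo_subset_Icc_self hx), mul_comm]
      exact sq_integral_le (L2eta_integrableOn _) (L2eta_integrable_sq _) (Ioo_subset_Icc_self hx)
    have hzero := eq_zero_of_tendsto_mul hGsq hvle hlim
    rw [hFint] at hzero
    rw [mul_div_cancel₀ _ hη1]
    linarith

/-! ### Dissipativity and the range condition -/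

theorem IsALambda.eq_add (hP : P.QuadraticBound) {lam : ℝ} {u : P.H10} {g : P.L2} :
    IsALambda lam u g ↔ ∃ h : P.L2, IsA u h ∧ g = h + lam • divD hP u := by
  refine exists_congr fun h => and_congr_right fun _ => ?_
  have he : ⇑(h + lam • divD hP u) =ᵐ[volume.restrict (Ioo (0 : ℝ) 1)]
      fun x => h x + lam * (rep u x / P.d x) := by
    filter_upwards [P.L2_add h (lam • divD hP u), P.L2_smul lam (divD hP u), coeFn_divD hP u]
      with x h1 h2 h3
    rw [h1, h2, h3]
  exact ⟨fun hg => L2_ext (hg.trans he.symm), fun hg => hg ▸ he⟩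

/-- Dissipativity: for `z = (u, v)` in the domain, `⟨𝒜 z, z⟩ = -v(1)²`. -/
theorem energyInner_waveGraph (hP : P.QuadraticBound) {lam β : ℝ} {z y : P.Phase}
    (h : (z, y) ∈ P.waveGraph lam β) : P.energyInner lam β y z = -rep y.fst 1 ^ 2 := by
  obtain ⟨h1, h2, q', hq', hbc⟩ := h
  dsimp only at h1 h2 hq' hbc
  obtain ⟨k, hk, hg⟩ := (IsALambda.eq_add hP).1 h1
  obtain ⟨q, hq, hgreen⟩ := hk.green
  have hqq : q' = q :=
    UniqueDiffWithinAt.eq_deriv _ (uniqueDiffOn_Icc zero_lt_one 1 (by simp)) hq' hq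
  rw [hqq] at hbc
  rw [energyInner_eq hP, ← h2, hg, inner_add_left, real_inner_smul_left,
    inner_divD_toL2_comm hP z.fst, real_inner_comm]
  linear_combination hgreen y.fst + rep y.fst 1 * hbc

/-- Test functions belong to `H¹_{1/σ,0}`. -/
theorem QuadraticBound.exists_of_isTest (hP : P.QuadraticBound) {φ : ℝ → ℝ} (hφ : IsTest φ) :
    ∃ u : P.H10, EqOn (rep u) φ (Icc 0 1) ∧
      ⇑(der u) =ᵐ[volume.restrict (Ioo (0 : ℝ) 1)] deriv φ := by
  have hc : Continuous (deriv φ) := hφ.1.continuous_deriv (by simp)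
  have hmem : MemLp (deriv φ) 2 P.etaMeasure := by
    refine (memLp_two_iff_integrable_sq hc.aestronglyMeasurable).2
      (P.integrable_etaMeasure_iff.2 ?_)
    exact ((P.continuousOn_eta.mul (hc.pow 2).continuousOn).integrableOn_Icc).mono_set
      Ioo_subset_Icc_self
  obtain ⟨u, hu⟩ := hP.exists_der_eq (hmem.toLp _)
  have hae : ⇑(der u) =ᵐ[volume.restrict (Ioo (0 : ℝ) 1)] deriv φ := by
    rw [hu]
    exact P.absolutelyContinuous_etaMeasure.ae_le hmem.coeFn_toLp
  refine ⟨u, fun x hx => ?_, hae⟩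
  have h0 : φ 0 = 0 := image_eq_zero_of_notMem_tsupport fun h => by simpa using hφ.2.2 h
  have h1 : ∫ s in (0 : ℝ)..x, der u s = ∫ s in (0 : ℝ)..x, deriv φ s := by
    refine intervalIntegral.integral_congr_ae_restrict ?_
    have hsub : uIoc 0 x ⊆ Ioc 0 1 := by
      rw [uIoc_of_le hx.1]
      exact Ioc_subset_Ioc_right hx.2
    refine ae_restrict_of_ae_restrict_of_subset hsub ?_
    rw [← restrict_Ioo_eq_restrict_Ioc]
    exact hae
  rw [rep_eq_integral u hx, h1, intervalIntegral.integral_deriv_eq_sub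
    (fun y _ => (hφ.1.differentiable (by simp)) y) (hc.intervalIntegrable _ _), h0, sub_zero]

theorem QuadraticBound.exists_rep_one_eq_one (hP : P.QuadraticBound) :
    ∃ u : P.H10, rep u 1 = 1 := by
  have hmem : MemLp (fun _ => (1 : ℝ)) 2 P.etaMeasure := by
    refine (memLp_two_iff_integrable_sq aestronglyMeasurable_const).2
      (P.integrable_etaMeasure_iff.2 ?_)
    exact ((P.continuousOn_eta.mul continuousOn_const).integrableOn_Icc).mono_set
      Ioo_subset_Icc_self
  obtain ⟨u, hu⟩ := hP.exists_der_eq (hmem.toLp _)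
  refine ⟨u, ?_⟩
  rw [rep_eq_integral u (by simp), ← integral_Ioo_eq, hu,
    integral_congr_ae (P.absolutelyContinuous_etaMeasure.ae_le hmem.coeFn_toLp)]
  simp

/-- The variational problem for `(μ² - A_λ) u = k` with the boundary condition
`η(1) u'(1) + γ u(1) = r`. -/
theorem QuadraticBound.exists_variational (hP : P.QuadraticBound) {lam : ℝ}
    (hlam : lam < 1 / P.hardyConst) (μ : ℝ) {γ : ℝ} (hγ : 0 ≤ γ) (k : P.L2) (r : ℝ) :
    ∃ u : P.H10, ∀ φ : P.H10,
      inner ℝ (der u) (der φ) + μ ^ 2 * inner ℝ (toL2 u) (toL2 φ)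
        - lam * inner ℝ (divD hP u) (toL2 φ) + γ * rep u 1 * rep φ 1 =
      inner ℝ k (toL2 φ) + r * rep φ 1 := by
  have := completeSpace_H10 hP
  let pull : (P.H10 →L[ℝ] P.L2) → P.H10 →L[ℝ] P.H10 →L[ℝ] ℝ := fun T =>
    (isBoundedBilinearMap_inner (𝕜 := ℝ)).toContinuousLinearMap.bilinearComp T P.toL2L
  let a : P.H10 →L[ℝ] P.H10 →L[ℝ] ℝ :=
    (isBoundedBilinearMap_inner (𝕜 := ℝ)).toContinuousLinearMap.bilinearComp P.derL P.derL
      + μ ^ 2 • pull P.toL2L - lam • pull (divD hP)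
      + γ • (ContinuousLinearMap.mul ℝ ℝ).bilinearComp P.evalOne P.evalOne
  have ha : ∀ u φ, a u φ = inner ℝ (der u) (der φ) + μ ^ 2 * inner ℝ (toL2 u) (toL2 φ)
        - lam * inner ℝ (divD hP u) (toL2 φ) + γ * rep u 1 * rep φ 1 := by
    intro u φ
    change inner ℝ (der u) (der φ) + μ ^ 2 * inner ℝ (toL2 u) (toL2 φ)
        - lam * inner ℝ (divD hP u) (toL2 φ) + γ * (rep u 1 * rep φ 1) = _
    ring
  obtain ⟨m, hm, hco⟩ := exists_coercive hP hlam
  obtain ⟨C, hC, hCu⟩ := exists_norm_le_der hP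
  have hcoer : IsCoercive a := by
    refine ⟨m / (C + 1), by positivity, fun u => ?_⟩
    rw [ha, real_inner_self_eq_norm_sq, real_inner_self_eq_norm_sq, mul_assoc, ← sq,
      div_mul_eq_mul_div, div_le_iff₀ (by positivity)]
    have h1 : 0 ≤ μ ^ 2 * ‖toL2 u‖ ^ 2 := by positivity
    have h2 : 0 ≤ γ * rep u 1 * rep u 1 := by
      rw [mul_assoc]
      exact mul_nonneg hγ (mul_self_nonneg _)
    have h3 : m * ‖u‖ ^ 2 ≤ m * ‖der u‖ ^ 2 * (C + 1) := by
      rw [mul_assoc]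
      have h4 := hCu u
      have h5 := sq_nonneg ‖der u‖
      gcongr
      linarith
    refine h3.trans ?_
    gcongr
    linarith [hco u]
  let l : P.H10 →L[ℝ] ℝ := (innerSL ℝ k).comp P.toL2L + r • P.evalOne
  refine ⟨hcoer.continuousLinearEquivOfBilin.symm ((InnerProductSpace.toDual ℝ P.H10).symm l),
    fun φ => ?_⟩
  rw [← ha, ← hcoer.continuousLinearEquivOfBilin_apply, ContinuousLinearEquiv.apply_symm_apply,
    InnerProductSpace.toDual_symm_apply]
  rfl

/-- The range condition: `μ - 𝒜` is onto for all `μ > 0`. -/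
theorem QuadraticBound.exists_waveGraph_sub (hP : P.QuadraticBound) {lam β : ℝ}
    (hlam : lam < 1 / P.hardyConst) (hβ : 0 ≤ β) {μ : ℝ} (hμ : 0 < μ) (w : P.Phase) :
    ∃ z y, (z, y) ∈ P.waveGraph lam β ∧ μ • z - y = w := by
  set f := w.fst with hf
  set g := w.snd with hg
  obtain ⟨u, hu⟩ := hP.exists_variational hlam μ (γ := μ + β) (by positivity)
    (μ • toL2 f + g) (rep f 1)
  set v : P.H10 := μ • u - f with hv
  -- The equation `μ v - A_λ u = g` with `v = μ u - f` prescribes `A_λ u = k`.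
  set k : P.L2 := μ • toL2 v - g with hk
  set h : P.L2 := k - lam • divD hP u with hh
  have hvtoL2 : toL2 v = μ • toL2 u - toL2 f := rfl
  have hweak : ∀ φ : P.H10, inner ℝ (der u) (der φ) + inner ℝ h (toL2 φ) =
      (rep f 1 - (μ + β) * rep u 1) * rep φ 1 := by
    intro φ
    have e := hu φ
    rw [hh, hk, hvtoL2]
    simp only [inner_sub_left, inner_add_left, real_inner_smul_left] at e ⊢
    linear_combination e
  have hA : IsA u h := by
    refine ⟨?_, L2_locallyIntegrableOn_div_sigma h, fun φ hφ => ?_⟩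
    · have h1 : IntegrableOn (fun x => der u x * P.eta x) (Icc 0 1) :=
        IntegrableOn.mul_continuousOn
          (by rw [integrableOn_Icc_iff_integrableOn_Ioo]; exact L2eta_integrableOn (der u))
          P.continuousOn_eta isCompact_Icc
      simp only [mul_comm (P.eta _)]
      exact (h1.mono_set Ioo_subset_Icc_self).locallyIntegrableOn
    · obtain ⟨ψ, hψ, hψ'⟩ := hP.exists_of_isTest hφ
      have e := hweak ψ
      have hφ1 : φ 1 = 0 := image_eq_zero_of_notMem_tsupport fun h => by simpa using hφ.2.2 h
      rw [hψ (by simp : (1 : ℝ) ∈ Icc (0 : ℝ) 1), hφ1, mul_zero, L2eta_inner, L2_inner] at e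
      have e1 : ∫ x in Ioo (0 : ℝ) 1, P.eta x * der u x * der ψ x =
          ∫ x in Ioo (0 : ℝ) 1, P.eta x * der u x * deriv φ x :=
        integral_congr_ae (hψ'.mono fun x hx => by simp only [hx])
      have e2 : ∫ x in Ioo (0 : ℝ) 1, h x * toL2 ψ x / P.sigma x =
          ∫ x in Ioo (0 : ℝ) 1, h x / P.sigma x * φ x := by
        refine integral_congr_ae ?_
        filter_upwards [toL2_eq_rep ψ, ae_restrict_mem measurableSet_Ioo] with x h1 hx
        rw [h1, hψ (Ioo_subset_Icc_self hx)]
        ring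
      rw [e1, e2] at e
      linarith
  obtain ⟨q, hq, hgreen⟩ := hA.green
  have hbc : P.eta 1 * q = rep f 1 - (μ + β) * rep u 1 := by
    obtain ⟨φ, hφ⟩ := hP.exists_rep_one_eq_one
    have h1 := hgreen φ
    rw [hweak φ, hφ, mul_one, mul_one] at h1
    exact h1.symm
  refine ⟨WithLp.toLp 2 (u, toL2 v), WithLp.toLp 2 (v, k), ⟨?_, rfl, q, hq, ?_⟩, ?_⟩
  · refine (IsALambda.eq_add hP).2 ⟨h, hA, ?_⟩
    change k = h + lam • divD hP u
    rw [hh, sub_add_cancel]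
  · change P.eta 1 * q + rep v 1 + β * rep u 1 = 0
    have hv1 : rep v 1 = μ * rep u 1 - rep f 1 := by
      simp only [← evalOne_apply, hv, map_sub, map_smul, smul_eq_mul]
    rw [hbc, hv1]
    ring
  · refine WithLp.ofLp_injective 2 (Prod.ext ?_ ?_)
    · change μ • u - v = w.fst
      rw [hv, ← hf, sub_sub_cancel]
    · change μ • toL2 v - k = w.snd
      rw [hk, ← hg, sub_sub_cancel]

end Coefficients

end DegWave

theorem theorem4p1 (P : DegWave.Coefficients) (K₁ K₂ lam β : ℝ)
    (hP : P.HasExponents K₁ K₂) (hK : K₁ + 2 * K₂ ≤ 2)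
    (hlam0 : lam ≠ 0) (hlam : lam < 1 / P.hardyConst) (hβ : 0 ≤ β) :
    -- the phase space is a Hilbert space, also under the (equivalent) energy inner product
    CompleteSpace P.Phase ∧ DegWave.IsEquivInner (P.energyInner lam β) ∧
    -- the operator is densely defined
    Dense ((P.waveOp lam β).domain : Set P.Phase) ∧
    -- the operator is dissipative (non positive) for the energy inner product
    (∀ z : (P.waveOp lam β).domain, P.energyInner lam β (P.waveOp lam β z) z ≤ 0) ∧
    -- `I - 𝒜` is surjective
    (∀ w : P.Phase, ∃ z : (P.waveOp lam β).domain, (z : P.Phase) - P.waveOp lam β z = w) ∧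
    -- the operator generates a semigroup of contractions for the energy norm
    ∃ S : ℝ≥0 → P.Phase →L[ℝ] P.Phase,
      DegWave.IsC0Semigroup S ∧ DegWave.IsGenerator (P.waveOp lam β) S ∧
      ∀ t z, P.energyInner lam β (S t z) (S t z) ≤ P.energyInner lam β z z := by
  have hQ := hP.quadraticBound hK
  have hH10 := DegWave.Coefficients.completeSpace_H10 hQ
  have hcomplete : CompleteSpace P.Phase := inferInstance
  have hB := DegWave.Coefficients.isEquivInner_energyInner hQ hlam hβ
  have hdiss : ∀ z y, (z, y) ∈ (P.waveOp lam β).graph → P.energyInner lam β y z ≤ 0 := by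
    intro z y h
    rw [P.waveOp_graph] at h
    rw [DegWave.Coefficients.energyInner_waveGraph hQ h]
    exact neg_nonpos.2 (sq_nonneg _)
  have hsurj : ∀ μ : ℝ, 0 < μ → ∀ w, ∃ z y, (z, y) ∈ (P.waveOp lam β).graph ∧ μ • z - y = w := by
    intro μ hμ w
    rw [P.waveOp_graph]
    exact hQ.exists_waveGraph_sub hlam hβ hμ w
  have hsurj1 : ∀ w, ∃ z y, (z, y) ∈ (P.waveOp lam β).graph ∧ z - y = w := fun w => by
    simpa only [one_smul] using hsurj 1 one_pos w
  refine ⟨hcomplete, hB, DegWave.dense_domain_of_dissipative hB hdiss hsurj1, ?_, ?_,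
    DegWave.exists_contraction_semigroup hB hdiss hsurj⟩
  · exact fun z => hdiss _ _ ((P.waveOp lam β).mem_graph z)
  · intro w
    obtain ⟨z, y, hzy, e⟩ := hsurj1 w
    obtain ⟨z', rfl, rfl⟩ := LinearPMap.mem_graph_iff _ |>.1 hzy
    exact ⟨z', e⟩
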